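/- **Proposition 4.** Let $\ell\ge 1$ and $n=2\ell+1$. Let $\Gamma^1,\dots,\Gamma^{n}$ be the $2^\ell\times 2^\ell$ Clifford matrices, defined recursively: for $\ell=1$ they are the Pauli matrices $X,Y,Z$, and from the matrices $\Gamma'^i$ for $\ell-1$ one gets $\Gamma^i=X\otimes\Gamma'^i$ ($i\le 2\ell-1$), $\Gamma^{2\ell}=Y\otimes 1$, $\Gamma^{2\ell+1}=Z\otimes 1$. Put $\Gamma^{ab}=[\Gamma^a,\Gamma^b]/2i$ for $a\ne b$, let $\mathcal S$ be the group generated by all $e^{-i\theta\Gamma^{ab}}$ ($\theta\in\mathbb R$), and say that an operator $V$ on $\mathbb C^{2^\ell}$ covers a real $n\times n$ matrix $R$ if $V^\dagger\Gamma^iV=\sum_jR_{ij}\Gamma^j$ for all $i$. A byproduct is a (possibly empty) product of matrices $\Gamma^a$. The $SO(n)$ AKLT state with on-site fundamental irrep (dimension $n$) and virtual spinor irrep (dimension $2^\ell$) is the matrix product state of $N$ spins with Kraus operators $A_a=\Gamma^a/\sqrt n$: jointly with the virtual system (correlator), initially in the state $|L\rangle$, it is $\sum_{i_1,\dots,i_N}|i_1\dots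 i_N\rangle\otimes A_{i_1}\cdots A_{i_N}|L\rangle$. The spins are measured one after another (site $N$ first, site $1$ last) in orthonormal bases with bras $\langle w_j|=\sum_i W_{ji}\langle i|$, $W$ unitary, where $W$ may depend on the earlier outcomes; outcomes have Born probabilities. Then: 1. *(The state.)* A family $(A_a)_{a=1}^n$ of operators on $\mathbb C^{2^\ell}$ satisfies $\sum_aA_a^\dagger A_a=1$ and the symmetry condition $\sum_jR_{ij}A_j=V^\dagger A_iV$ for all $i$, all $R\in SO(n)$ and all $V\in\mathcal S$ covering $R$, if and only if $A_a=z\,\Gamma^a/\sqrt n$ for all $a$ with one phase $z$. 2. *(Byproducts.)* Each $\Gamma^a$ is a tensor product of $\ell$ matrices from $\{1,X,Y,Z\}$, and each byproduct is such a tensor product times a fourth root of unity. 3. *(Gates.)* Let $G$ be the set of unitaries $U$ on $\mathbb C^{2^\ell}$ such that, for some $N$, some measurement as above and some sequence of outcomes, the correlator goes from $|L\rangle$ to $cU|L\rangle$ for all $|L\rangle$, with a constant $c\neq0$. Then $G$ is a group, and there is a surjective homomorphism $\pi:G\to SO(n)$, with kernel exactly the global phases, such that each $U\in G$ covers $\pi(U)$;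 so the induced gates form $SO(n)$. In spinor form: $\mathcal S\subseteq G$; each $R\in SO(n)$ equals $\pi(V)$ for some $V=\prod_{a<b}e^{-i\theta_{ab}\Gamma^{ab}}$ (pairs in lexicographic order), and each $U\in G$ is a phase times such a product. 4. *(Measurement bases.)* For $V\in\mathcal S$ the matrix $u_{ij}(V)=\mathrm{tr}(\Gamma^iV\Gamma^jV^\dagger)/2^\ell$ is the matrix in $SO(n)$ covered by $V$. Measuring $N$ spins in the bases $u(V_k)$, with $V_k\in\mathcal S$ for site $k$ (possibly depending on the earlier outcomes), and obtaining the outcomes $j_1,\dots,j_N$ takes $|L\rangle$ to $n^{-N/2}\prod_{k=1}^N(V_k^\dagger\Gamma^{j_k}V_k)|L\rangle$ (factors ordered from left to right), and this has probability $n^{-N}$ for every normalized $|L\rangle$. 5. *(Success probability.)* Let $B$ be a byproduct that has accumulated so far and let $a\ne b$. There is $\varepsilon\in\{1,-1\}$ such that for all $\varphi\in\mathbb R$: $Be^{-i\varphi\Gamma^{ab}}=e^{-i\varepsilon\varphi\Gamma^{ab}}B$; and if the next spin is measured in the basis $u(e^{-i(\varepsilon\varphi/2)\Gamma^{ab}})$,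 then, up to nonzero scalars, for all virtual states $\psi$, an outcome $j\in\{a,b\}$ takes $B\psi$ to $\Gamma^jB\,e^{-i\varphi\Gamma^{ab}}\psi$ (the gate is performed, the new byproduct being $\Gamma^jB$), and an outcome $j\notin\{a,b\}$ takes $B\psi$ to $\Gamma^jB\psi$ (the identity is performed). If $\sin\varphi\ne0$ (nontrivial gate), then for every normalized state of the correlator the probability of an outcome $j$ that performs $e^{-i\varphi\Gamma^{ab}}$ in this sense is $2/(2\ell+1)$, and the probability of an outcome that performs the identity is $1-2/(2\ell+1)$. -/

import Mathlib

open Matrix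
open scoped Kronecker

noncomputable section

namespace SOAKLT

/-- The identity and the three Pauli matrices `X, Y, Z`. -/
def pauli : Fin 4 → Matrix (Fin 2) (Fin 2) ℂ :=
  ![1, !![0, 1; 1, 0], !![0, -Complex.I; Complex.I, 0], !![1, 0; 0, -1]]

/-- Index set of the standard basis of the space of `ℓ` qubits (the virtual space). -/
def QIdx : ℕ → Type
  | 0 => Unit
  | ℓ + 1 => Fin 2 × QIdx ℓ

instance instFintypeQIdx : (ℓ : ℕ) → Fintype (QIdx ℓ)
  | 0 => inferInstanceAs (Fintype Unit)
  | ℓ + 1 => @instFintypeProd (Fin 2) (QIdx ℓ) _ (instFintypeQIdx ℓ)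

instance instDecidableEqQIdx : (ℓ : ℕ) → DecidableEq (QIdx ℓ)
  | 0 => inferInstanceAs (DecidableEq Unit)
  | ℓ + 1 => @instDecidableEqProd (Fin 2) (QIdx ℓ) _ (instDecidableEqQIdx ℓ)

/-- The virtual space has dimension `2 ^ ℓ`. -/
theorem card_qIdx : (ℓ : ℕ) → Fintype.card (QIdx ℓ) = 2 ^ ℓ
  | 0 => rfl
  | ℓ + 1 => by
    have h : Fintype.card (QIdx (ℓ + 1)) = Fintype.card (Fin 2) * Fintype.card (QIdx ℓ) :=
      Fintype.card_prod _ _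
    rw [h, card_qIdx ℓ, Fintype.card_fin, pow_succ, mul_comm]

/-- Operators on the virtual space. -/
abbrev VOp (ℓ : ℕ) : Type := Matrix (QIdx ℓ) (QIdx ℓ) ℂ

/-- The on-site index set `{1, …, 2ℓ+1}` (shifted to start at `0`). -/
abbrev Site (ℓ : ℕ) : Type := Fin (2 * ℓ + 1)

/-- The tensor product `pauli (p 0) ⊗ ⋯ ⊗ pauli (p (ℓ-1))`. -/
def pauliString : (ℓ : ℕ) → (Fin ℓ → Fin 4) → VOp ℓ
  | 0, _ => (1 : Matrix Unit Unit ℂ)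
  | ℓ + 1, p => pauli (p 0) ⊗ₖ pauliString ℓ (Fin.tail p)

/-- The Clifford matrices `Γ^a`, by recursion on `ℓ`: the old ones are tensored with `X` on the
left, and the two last ones are `Y ⊗ 1` and `Z ⊗ 1`. Starting the recursion from the `1 × 1`
matrix `1` gives `X, Y, Z` at `ℓ = 1`. -/
def Γ : (ℓ : ℕ) → Site ℓ → VOp ℓ
  | 0 => fun _ => (1 : Matrix Unit Unit ℂ)
  | ℓ + 1 =>
    Fin.snoc (n := 2 * ℓ + 2) (α := fun _ => VOp (ℓ + 1))
      (Fin.snoc (n := 2 * ℓ + 1) (α := fun _ => VOp (ℓ + 1))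
        (fun i => pauli 1 ⊗ₖ Γ ℓ i) (pauli 2 ⊗ₖ (1 : VOp ℓ)))
      (pauli 3 ⊗ₖ (1 : VOp ℓ))

/-- The generators `Γ^{ab} = [Γ^a, Γ^b] / (2i)` of the spinor representation. -/
def gen (ℓ : ℕ) (a b : Site ℓ) : VOp ℓ :=
  (1 / (2 * Complex.I)) • (Γ ℓ a * Γ ℓ b - Γ ℓ b * Γ ℓ a)

/-- The gate `exp(-iθ Γ^{ab})`. -/
def rot (ℓ : ℕ) (a b : Site ℓ) (θ : ℝ) : VOp ℓ :=
  NormedSpace.exp ((-(Complex.I * (θ : ℂ))) • gen ℓ a b)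

/-- The product `∏_{a<b} exp(-iθ_{ab} Γ^{ab})` of `ℓ(2ℓ+1)` gates, in lexicographic order of the
pairs from left to right. -/
def spinorProd (ℓ : ℕ) (θ : Site ℓ → Site ℓ → ℝ) : VOp ℓ :=
  ((List.finRange (2 * ℓ + 1)).map fun a =>
    (((List.finRange (2 * ℓ + 1)).filter fun b => a < b).map fun b => rot ℓ a b (θ a b)).prod).prod

/-- The spinor form of the group: everything generated by the gates `exp(-iθ Γ^{ab})`.
The generating set is closed under inverses (`θ ↦ -θ`). -/
def spinGates (ℓ : ℕ) : Submonoid (VOp ℓ) :=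
  Submonoid.closure {V | ∃ a b : Site ℓ, a ≠ b ∧ ∃ θ : ℝ, V = rot ℓ a b θ}

/-- Byproduct operators: the Clifford matrices and their products. -/
def byproducts (ℓ : ℕ) : Submonoid (VOp ℓ) :=
  Submonoid.closure (Set.range (Γ ℓ))

/-- `V` acts on the Clifford matrices through the rotation `R`: `V† Γ^i V = ∑_j R_{ij} Γ^j`. -/
def Covers (ℓ : ℕ) (V : VOp ℓ) (R : Matrix (Site ℓ) (Site ℓ) ℝ) : Prop :=
  ∀ i, Vᴴ * Γ ℓ i * V = ∑ j, (R i j : ℂ) • Γ ℓ j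

/-- The defining property of an AKLT tensor with on-site fundamental and virtual spinor irrep:
trace preservation `∑ A_i† A_i = 1` and the symmetry condition
`∑_j R_{ij} A_j = V(R)† A_i V(R)`, where `V(R)` is a spinor form of `R ∈ SO(2ℓ+1)`. -/
def IsAKLTTensor (ℓ : ℕ) (A : Site ℓ → VOp ℓ) : Prop :=
  (∑ i, (A i)ᴴ * A i = 1) ∧
  ∀ R ∈ Matrix.specialOrthogonalGroup (Site ℓ) ℝ, ∀ V ∈ spinGates ℓ, Covers ℓ V R →
    ∀ i, ∑ j, (R i j : ℂ) • A j = Vᴴ * A i * V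

/-- The Kraus operators `A_a = Γ^a / √(2ℓ+1)` of the AKLT state. -/
def kraus (ℓ : ℕ) (a : Site ℓ) : VOp ℓ :=
  (((Real.sqrt (2 * ℓ + 1))⁻¹ : ℝ) : ℂ) • Γ ℓ a

/-- The AKLT matrix product state of `N` spins, jointly with the correlator, for the initial
correlator state `L`: the component at `|i_1 … i_N⟩` is the correlator vector
`A_{i_1} ⋯ A_{i_N} |L⟩`. Contraction with `⟨R|` gives the amplitudes of the open chain. -/
def akltState (ℓ N : ℕ) (L : QIdx ℓ → ℂ) (i : Fin N → Site ℓ) : QIdx ℓ → ℂ :=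
  (List.ofFn fun k => kraus ℓ (i k)).prod *ᵥ L

/-- The outcomes obtained before site `k` is measured (latest first): site `N`, whose Kraus
operator acts first on the correlator, is measured first. -/
def history {ℓ N : ℕ} (s : Fin N → Site ℓ) (k : Fin N) : List (Site ℓ) :=
  (List.ofFn s).drop (k + 1)

/-- The (unnormalized) correlator state after an adaptive projective measurement of the `N` spins
with outcomes `s`. After the outcomes `h` the next spin is measured in the orthonormal basis whose
bras are the rows `⟨w_j| = ∑_i W(h)_{ji} ⟨i|` of the unitary matrix `W h`. -/
def postState {ℓ N : ℕ} (W : List (Site ℓ) → Matrix (Site ℓ) (Site ℓ) ℂ)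
    (s : Fin N → Site ℓ) (L : QIdx ℓ → ℂ) : QIdx ℓ → ℂ :=
  ∑ i : Fin N → Site ℓ, (∏ k, W (history s k) (s k) (i k)) • akltState ℓ N L i

/-- Squared norm of a vector of the virtual space. -/
def normSq {ℓ : ℕ} (ψ : QIdx ℓ → ℂ) : ℝ := ∑ x, ‖ψ x‖ ^ 2

/-- Born probability of the outcomes `s`, for a normalized initial correlator state `L`. -/
def outcomeProb {ℓ N : ℕ} (W : List (Site ℓ) → Matrix (Site ℓ) (Site ℓ) ℂ)
    (s : Fin N → Site ℓ) (L : QIdx ℓ → ℂ) : ℝ := normSq (postState W s L)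

/-- The unitary gates on the virtual space that some outcome of nonzero probability of some
adaptive on-site projective measurement of some number of spins induces. -/
def inducedGates (ℓ : ℕ) : Set (Matrix.unitaryGroup (QIdx ℓ) ℂ) :=
  {U | ∃ (N : ℕ) (W : List (Site ℓ) → Matrix (Site ℓ) (Site ℓ) ℂ) (s : Fin N → Site ℓ) (c : ℂ),
    (∀ h, W h ∈ Matrix.unitaryGroup (Site ℓ) ℂ) ∧ c ≠ 0 ∧
    ∀ L, postState W s L = c • ((U : VOp ℓ) *ᵥ L)}

/-- The measurement basis belonging to the virtual operator `V`:
`u_{ij} = tr(Γ^i V Γ^j V†) / 2^ℓ`. -/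
def measBasis (ℓ : ℕ) (V : VOp ℓ) : Matrix (Site ℓ) (Site ℓ) ℂ :=
  Matrix.of fun i j => Matrix.trace (Γ ℓ i * V * Γ ℓ j * Vᴴ) / 2 ^ ℓ

/-- With the byproduct `B` already accumulated, the outcome `j` of measuring the next spin in the
basis `W` performs the gate `G`: up to a nonzero scalar the correlator goes from `B ψ` to
`(Γ^j B) (G ψ)`, that is, `G` is performed and the new byproduct is `Γ^j B`. -/
def Performs (ℓ : ℕ) (W : Matrix (Site ℓ) (Site ℓ) ℂ) (B G : VOp ℓ) (j : Site ℓ) : Prop :=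
  ∃ c : ℂ, c ≠ 0 ∧ ∀ ψ : QIdx ℓ → ℂ,
    postState (fun _ => W) (fun _ : Fin 1 => j) (B *ᵥ ψ) = c • ((Γ ℓ j * B * G) *ᵥ ψ)

open Classical in
/-- Probability that measuring one spin in the basis `W`, with byproduct `B` accumulated and the
correlator in the normalized state `χ`, performs the gate `G` (up to the byproduct). -/
def performProb (ℓ : ℕ) (W : Matrix (Site ℓ) (Site ℓ) ℂ) (B G : VOp ℓ) (χ : QIdx ℓ → ℂ) : ℝ :=
  ∑ j ∈ Finset.univ.filter (fun j => Performs ℓ W B G j),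
    outcomeProb (fun _ => W) (fun _ : Fin 1 => j) χ

end SOAKLT

end

open SOAKLT

noncomputable section

namespace SOAKLT

/-! Everything follows from the Clifford relations: the `Γ ℓ a` are Hermitian, square to 1,
anticommute pairwise, act irreducibly (`eq_smul_one_of_commute_Γ`), and, their number being odd,
have a scalar as their ordered product (`prod_Γ`), so that even words alone act irreducibly
(`eq_smul_one_of_commute_even`).

Uniqueness of the tensor: half turns force `A a` to commute or anticommute with each pair product
exactly as `Γ ℓ a` does. Hence `A a * Γ ℓ a` commutes with all even words and is a scalar; quarter
turns make the scalars equal, and trace preservation fixes the modulus.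

Gates: a measurement record turns the state into a product of complex vectors `∑ w_j Γ^j`, one per
site (`postState_eq`). An invertible vector acts by conjugation as minus a reflection, of
determinant 1 in odd dimension, so an induced unitary covers a rotation
(`exists_covers_of_mem_inducedGates`). Conversely, every rotation is a product of plane rotations
(`exists_eq_prod_givensRow`), covered by gates, and each gate is a product of two operators `V† Γ^j
V`, which is what measuring in the basis of `V` inserts. By irreducibility, unitaries covering one
rotation differ by a phase (`eq_smul_of_covers`), so the induced gates are exactly the unitaries
covering rotations.

Success probability: for a half-angle gate `V`, the operator `V† Γ^j V` is `Γ^j` times the full gate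
if `j` is `a` or `b`, and `Γ^j` otherwise. All outcomes are equally likely, so the probabilities
come from counting. -/

/-! ### Tensoring with one more qubit -/

/-- `P ⊗ M` as an operator on one more qubit. -/
def tensorLeft {ℓ : ℕ} (P : Matrix (Fin 2) (Fin 2) ℂ) (M : VOp ℓ) : VOp (ℓ + 1) := P ⊗ₖ M

theorem tensorLeft_mul {ℓ : ℕ} (P Q : Matrix (Fin 2) (Fin 2) ℂ) (M N : VOp ℓ) :
    tensorLeft P M * tensorLeft Q N = tensorLeft (P * Q) (M * N) :=
  (Matrix.mul_kronecker_mul P Q M N).symm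

theorem tensorLeft_one {ℓ : ℕ} : tensorLeft 1 (1 : VOp ℓ) = 1 :=
  Matrix.one_kronecker_one

theorem tensorLeft_conjTranspose {ℓ : ℕ} (P : Matrix (Fin 2) (Fin 2) ℂ) (M : VOp ℓ) :
    (tensorLeft P M)ᴴ = tensorLeft Pᴴ Mᴴ :=
  Matrix.conjTranspose_kronecker P M

theorem tensorLeft_smul_left {ℓ : ℕ} (z : ℂ) (P : Matrix (Fin 2) (Fin 2) ℂ) (M : VOp ℓ) :
    tensorLeft (z • P) M = z • tensorLeft P M :=
  Matrix.smul_kronecker z P M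

theorem tensorLeft_smul_right {ℓ : ℕ} (z : ℂ) (P : Matrix (Fin 2) (Fin 2) ℂ) (M : VOp ℓ) :
    tensorLeft P (z • M) = z • tensorLeft P M :=
  Matrix.kronecker_smul z P M

/-- Basis index of one more qubit. -/
def qPair {ℓ : ℕ} (a : Fin 2) (x : QIdx ℓ) : QIdx (ℓ + 1) := (a, x)

theorem exists_qPair {ℓ : ℕ} (p : QIdx (ℓ + 1)) : ∃ a x, p = qPair a x := ⟨p.1, p.2, rfl⟩

theorem tensorLeft_apply {ℓ : ℕ} (P : Matrix (Fin 2) (Fin 2) ℂ) (M : VOp ℓ) (a b : Fin 2)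
    (x y : QIdx ℓ) : tensorLeft P M (qPair a x) (qPair b y) = P a b * M x y := rfl

theorem tensorLeft_injective_right {ℓ : ℕ} {M N : VOp ℓ} {P : Matrix (Fin 2) (Fin 2) ℂ}
    {a b : Fin 2} (hP : P a b ≠ 0) (h : tensorLeft P M = tensorLeft P N) : M = N := by
  ext x y
  have := congrFun (congrFun h (qPair a x)) (qPair b y)
  rw [tensorLeft_apply, tensorLeft_apply] at this
  exact mul_left_cancel₀ hP this

/-! ### Pauli matrices -/

theorem pauli_conjTranspose (i : Fin 4) : (pauli i)ᴴ = pauli i := by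
  fin_cases i <;> ext a b <;> fin_cases a <;> fin_cases b <;> simp [pauli]

theorem pauli_mul_self (i : Fin 4) : pauli i * pauli i = 1 := by
  fin_cases i <;> ext a b <;> fin_cases a <;> fin_cases b <;> simp [pauli]

theorem pauli_zero : pauli 0 = 1 := rfl

theorem pauli_anticomm {i j : Fin 4} (hi : i ≠ 0) (hj : j ≠ 0) (hij : i ≠ j) :
    pauli i * pauli j = -(pauli j * pauli i) := by
  fin_cases i <;> fin_cases j <;> simp at hi hj hij <;> ext a b <;> fin_cases a <;> fin_cases b <;>
    simp [pauli]

theorem pauli_xyz : pauli 1 * pauli 2 * pauli 3 = Complex.I • 1 := by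
  ext a b; fin_cases a <;> fin_cases b <;> simp [pauli]

theorem exists_pauli_mul (i j : Fin 4) :
    ∃ (z : ℂ) (k : Fin 4), z ^ 4 = 1 ∧ pauli i * pauli j = z • pauli k := by
  have hI : Complex.I ^ 4 = 1 := Complex.I_pow_four
  have h12 : pauli 1 * pauli 2 = Complex.I • pauli 3 := by
    ext a b; fin_cases a <;> fin_cases b <;> simp [pauli]
  have h23 : pauli 2 * pauli 3 = Complex.I • pauli 1 := by
    ext a b; fin_cases a <;> fin_cases b <;> simp [pauli]
  have h31 : pauli 3 * pauli 1 = Complex.I • pauli 2 := by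
    ext a b; fin_cases a <;> fin_cases b <;> simp [pauli]
  have swap : ∀ {i j k : Fin 4}, i ≠ 0 → j ≠ 0 → i ≠ j →
      pauli i * pauli j = Complex.I • pauli k → pauli j * pauli i = (-Complex.I) • pauli k := by
    intro i j k hi hj hij h
    rw [pauli_anticomm hj hi hij.symm, h, neg_smul]
  have hI' : (-Complex.I) ^ 4 = 1 := by rw [neg_pow, hI]; norm_num
  by_cases hi : i = 0
  · exact ⟨1, j, one_pow _, by simp [hi, pauli_zero]⟩
  by_cases hj : j = 0
  · exact ⟨1, i, one_pow _, by simp [hj, pauli_zero]⟩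
  by_cases hij : i = j
  · exact ⟨1, 0, one_pow _, by rw [hij, pauli_mul_self, pauli_zero, one_smul]⟩
  have : (i = 1 ∧ j = 2) ∨ (i = 2 ∧ j = 3) ∨ (i = 3 ∧ j = 1) ∨
      (i = 2 ∧ j = 1) ∨ (i = 3 ∧ j = 2) ∨ (i = 1 ∧ j = 3) := by
    revert i j; decide
  rcases this with ⟨rfl, rfl⟩ | ⟨rfl, rfl⟩ | ⟨rfl, rfl⟩ | ⟨rfl, rfl⟩ | ⟨rfl, rfl⟩ | ⟨rfl, rfl⟩
  · exact ⟨_, _, hI, h12⟩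
  · exact ⟨_, _, hI, h23⟩
  · exact ⟨_, _, hI, h31⟩
  · exact ⟨_, _, hI', swap (by decide) (by decide) (by decide) h12⟩
  · exact ⟨_, _, hI', swap (by decide) (by decide) (by decide) h23⟩
  · exact ⟨_, _, hI', swap (by decide) (by decide) (by decide) h31⟩

/-! ### The recursion for the Clifford matrices -/

theorem Γ_succ (ℓ : ℕ) : Γ (ℓ + 1) =
    Fin.snoc (n := 2 * ℓ + 2) (α := fun _ => VOp (ℓ + 1))
      (Fin.snoc (n := 2 * ℓ + 1) (α := fun _ => VOp (ℓ + 1))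
        (fun i => tensorLeft (pauli 1) (Γ ℓ i)) (tensorLeft (pauli 2) 1))
      (tensorLeft (pauli 3) 1) := rfl

theorem Γ_old (ℓ : ℕ) (i : Site ℓ) :
    Γ (ℓ + 1) (Fin.castSucc (Fin.castSucc i)) = tensorLeft (pauli 1) (Γ ℓ i) :=
  (congrFun (Γ_succ ℓ) _).trans
    ((Fin.snoc_castSucc (n := 2 * ℓ + 2) (α := fun _ => VOp (ℓ + 1)) _ _ _).trans
      (Fin.snoc_castSucc (n := 2 * ℓ + 1) (α := fun _ => VOp (ℓ + 1)) _ _ _))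

theorem Γ_penultimate (ℓ : ℕ) :
    Γ (ℓ + 1) (Fin.castSucc (Fin.last (2 * ℓ + 1))) = tensorLeft (pauli 2) (1 : VOp ℓ) :=
  (congrFun (Γ_succ ℓ) _).trans
    ((Fin.snoc_castSucc (n := 2 * ℓ + 2) (α := fun _ => VOp (ℓ + 1)) _ _ _).trans
      (Fin.snoc_last (n := 2 * ℓ + 1) (α := fun _ => VOp (ℓ + 1)) _ _))

theorem Γ_last (ℓ : ℕ) :
    Γ (ℓ + 1) (Fin.last (2 * ℓ + 2)) = tensorLeft (pauli 3) (1 : VOp ℓ) :=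
  (congrFun (Γ_succ ℓ) _).trans
    (Fin.snoc_last (n := 2 * ℓ + 2) (α := fun _ => VOp (ℓ + 1)) _ _)

theorem forall_site_succ {ℓ : ℕ} {P : Site (ℓ + 1) → Prop}
    (h1 : ∀ i : Site ℓ, P (Fin.castSucc (Fin.castSucc i)))
    (h2 : P (Fin.castSucc (Fin.last (2 * ℓ + 1)))) (h3 : P (Fin.last (2 * ℓ + 2))) : ∀ i, P i := by
  intro i
  refine Fin.lastCases (n := 2 * ℓ + 2) (motive := P) h3 (fun j => ?_) i
  exact Fin.lastCases (n := 2 * ℓ + 1) (motive := fun j => P (Fin.castSucc j)) h2 h1 j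

theorem Γ_conjTranspose : ∀ (ℓ : ℕ) (a : Site ℓ), (Γ ℓ a)ᴴ = Γ ℓ a
  | 0, _ => Matrix.conjTranspose_one
  | ℓ + 1, a => by
    revert a
    refine forall_site_succ (fun i => ?_) ?_ ?_
    · rw [Γ_old, tensorLeft_conjTranspose, pauli_conjTranspose, Γ_conjTranspose]
    · rw [Γ_penultimate, tensorLeft_conjTranspose, pauli_conjTranspose, conjTranspose_one]
    · rw [Γ_last, tensorLeft_conjTranspose, pauli_conjTranspose, conjTranspose_one]

theorem Γ_mul_self : ∀ (ℓ : ℕ) (a : Site ℓ), Γ ℓ a * Γ ℓ a = 1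
  | 0, _ => Matrix.mul_one _
  | ℓ + 1, a => by
    revert a
    refine forall_site_succ (fun i => ?_) ?_ ?_
    · rw [Γ_old, tensorLeft_mul, pauli_mul_self, Γ_mul_self, tensorLeft_one]
    · rw [Γ_penultimate, tensorLeft_mul, pauli_mul_self, mul_one, tensorLeft_one]
    · rw [Γ_last, tensorLeft_mul, pauli_mul_self, mul_one, tensorLeft_one]

theorem tensorLeft_neg_left {ℓ : ℕ} (P : Matrix (Fin 2) (Fin 2) ℂ) (M : VOp ℓ) :
    tensorLeft (-P) M = -tensorLeft P M := by
  rw [← neg_one_smul ℂ, tensorLeft_smul_left, neg_one_smul]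

theorem tensorLeft_neg_right {ℓ : ℕ} (P : Matrix (Fin 2) (Fin 2) ℂ) (M : VOp ℓ) :
    tensorLeft P (-M) = -tensorLeft P M := by
  rw [← neg_one_smul ℂ, tensorLeft_smul_right, neg_one_smul]

theorem tensorLeft_pauli_anticomm {ℓ : ℕ} {i j : Fin 4} (hi : i ≠ 0) (hj : j ≠ 0) (hij : i ≠ j)
    {M N : VOp ℓ} (h : M * N = N * M) :
    tensorLeft (pauli i) M * tensorLeft (pauli j) N =
      -(tensorLeft (pauli j) N * tensorLeft (pauli i) M) := by
  rw [tensorLeft_mul, tensorLeft_mul, pauli_anticomm hi hj hij, h, tensorLeft_neg_left]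

theorem Γ_anticomm : ∀ (ℓ : ℕ) {a b : Site ℓ}, a ≠ b → Γ ℓ a * Γ ℓ b = -(Γ ℓ b * Γ ℓ a)
  | 0, a, b => fun h => (h (Subsingleton.elim (α := Fin 1) a b)).elim
  | ℓ + 1, a, b => by
    have d12 : (1 : Fin 4) ≠ 2 := by decide
    have d13 : (1 : Fin 4) ≠ 3 := by decide
    have d23 : (2 : Fin 4) ≠ 3 := by decide
    have d10 : (1 : Fin 4) ≠ 0 := by decide
    have d20 : (2 : Fin 4) ≠ 0 := by decide
    have d30 : (3 : Fin 4) ≠ 0 := by decide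
    revert a b
    refine forall_site_succ (fun i => forall_site_succ (fun j => ?_) ?_ ?_)
      (forall_site_succ (fun j => ?_) ?_ ?_) (forall_site_succ (fun j => ?_) ?_ ?_)
    · intro hij
      have : i ≠ j := fun h => hij (by rw [h])
      rw [Γ_old, Γ_old, tensorLeft_mul, tensorLeft_mul, Γ_anticomm ℓ this, tensorLeft_neg_right]
    all_goals
      intro h
      first
      | exact (h rfl).elim
      | simp only [Γ_old, Γ_penultimate, Γ_last]
        apply tensorLeft_pauli_anticomm <;> first | assumption | exact Ne.symm (by assumption) | simp

/-! ### Trace orthogonality and the bilinear Clifford relations. -/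

theorem two_pow_ne_zero_complex (ℓ : ℕ) : ((2 : ℂ) ^ ℓ) ≠ 0 := pow_ne_zero _ two_ne_zero

theorem trace_one_vOp (ℓ : ℕ) : Matrix.trace (1 : VOp ℓ) = 2 ^ ℓ := by
  rw [Matrix.trace_one, card_qIdx]; push_cast; rfl

/-- For distinct indices, anticommutation and cyclicity make the trace its own negative. -/
theorem trace_Γ_mul_Γ (ℓ : ℕ) (a b : Site ℓ) :
    Matrix.trace (Γ ℓ a * Γ ℓ b) = if a = b then 2 ^ ℓ else 0 := by
  split_ifs with h
  · rw [h, Γ_mul_self, trace_one_vOp]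
  · have h1 := congrArg Matrix.trace (Γ_anticomm ℓ h)
    rw [Matrix.trace_neg, Matrix.trace_mul_comm (Γ ℓ b)] at h1
    exact self_eq_neg.mp h1

/-- Coefficients with respect to the Clifford matrices are read off by the trace. -/
theorem trace_sum_smul_Γ_mul (ℓ : ℕ) (w : Site ℓ → ℂ) (b : Site ℓ) :
    Matrix.trace ((∑ j, w j • Γ ℓ j) * Γ ℓ b) = w b * 2 ^ ℓ := by
  simp [Finset.sum_mul, Matrix.trace_sum, trace_Γ_mul_Γ]

theorem sum_smul_Γ_injective (ℓ : ℕ) {w w' : Site ℓ → ℂ}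
    (h : ∑ j, w j • Γ ℓ j = ∑ j, w' j • Γ ℓ j) : w = w' := by
  funext b
  have := congrArg (fun M => Matrix.trace (M * Γ ℓ b)) h
  simp only [trace_sum_smul_Γ_mul] at this
  exact mul_right_cancel₀ (two_pow_ne_zero_complex ℓ) this

theorem Γ_anticommutator (ℓ : ℕ) (i j : Site ℓ) :
    Γ ℓ i * Γ ℓ j + Γ ℓ j * Γ ℓ i = if i = j then (2 : ℂ) • (1 : VOp ℓ) else 0 := by
  split_ifs with h
  · rw [h, Γ_mul_self, two_smul]
  · rw [Γ_anticomm ℓ h, neg_add_cancel]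

/-- The Clifford relations in bilinear form. -/
theorem sum_smul_Γ_anticommutator (ℓ : ℕ) (w w' : Site ℓ → ℂ) :
    (∑ j, w j • Γ ℓ j) * (∑ j, w' j • Γ ℓ j) + (∑ j, w' j • Γ ℓ j) * (∑ j, w j • Γ ℓ j) =
      (2 * ∑ j, w j * w' j) • (1 : VOp ℓ) := by
  have h2 : (∑ j, w' j • Γ ℓ j) * (∑ j, w j • Γ ℓ j) =
      ∑ i, ∑ j, (w i * w' j) • (Γ ℓ j * Γ ℓ i) := by
    rw [Finset.sum_mul_sum, Finset.sum_comm]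
    refine Finset.sum_congr rfl fun i _ => Finset.sum_congr rfl fun j _ => ?_
    rw [smul_mul_smul_comm, mul_comm]
  have h1 : (∑ j, w j • Γ ℓ j) * (∑ j, w' j • Γ ℓ j) =
      ∑ i, ∑ j, (w i * w' j) • (Γ ℓ i * Γ ℓ j) := by
    rw [Finset.sum_mul_sum]
    refine Finset.sum_congr rfl fun i _ => Finset.sum_congr rfl fun j _ => ?_
    rw [smul_mul_smul_comm]
  rw [h1, h2, ← Finset.sum_add_distrib, Finset.mul_sum, Finset.sum_smul]
  refine Finset.sum_congr rfl fun i _ => ?_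
  rw [← Finset.sum_add_distrib]
  simp only [← smul_add, Γ_anticommutator, smul_ite, smul_zero, Finset.sum_ite_eq, Finset.mem_univ, if_true,
    smul_smul]
  rw [mul_comm]

/-! ### Irreducibility -/

theorem sum_qIdx_succ {ℓ : ℕ} (f : QIdx (ℓ + 1) → ℂ) :
    ∑ x, f x = ∑ a : Fin 2, ∑ x : QIdx ℓ, f (qPair a x) :=
  Fintype.sum_prod_type (f := (f : Fin 2 × QIdx ℓ → ℂ))

theorem tensorLeft_one_mul_apply {ℓ : ℕ} (P : Matrix (Fin 2) (Fin 2) ℂ) (M : VOp (ℓ + 1))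
    (a : Fin 2) (x : QIdx ℓ) (y : QIdx (ℓ + 1)) :
    (tensorLeft P (1 : VOp ℓ) * M : VOp (ℓ + 1)) (qPair a x) y = ∑ c, P a c * M (qPair c x) y := by
  rw [Matrix.mul_apply, sum_qIdx_succ]
  refine Finset.sum_congr rfl fun c _ => ?_
  simp [tensorLeft_apply, Matrix.one_apply]

theorem mul_tensorLeft_one_apply {ℓ : ℕ} (P : Matrix (Fin 2) (Fin 2) ℂ) (M : VOp (ℓ + 1))
    (a : Fin 2) (x : QIdx ℓ) (y : QIdx (ℓ + 1)) :
    (M * tensorLeft P (1 : VOp ℓ) : VOp (ℓ + 1)) y (qPair a x) = ∑ c, M y (qPair c x) * P c a := by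
  rw [Matrix.mul_apply, sum_qIdx_succ]
  refine Finset.sum_congr rfl fun c _ => ?_
  simp [tensorLeft_apply, Matrix.one_apply]

/-- An operator that commutes with `Y ⊗ 1` and `Z ⊗ 1` acts trivially on the first qubit. -/
theorem eq_tensorLeft_of_commute {ℓ : ℕ} (M : VOp (ℓ + 1))
    (h2 : tensorLeft (pauli 2) (1 : VOp ℓ) * M = M * tensorLeft (pauli 2) (1 : VOp ℓ))
    (h3 : tensorLeft (pauli 3) (1 : VOp ℓ) * M = M * tensorLeft (pauli 3) (1 : VOp ℓ)) :
    ∃ M' : VOp ℓ, M = tensorLeft 1 M' := by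
  have e : ∀ (i : Fin 4), tensorLeft (pauli i) (1 : VOp ℓ) * M = M * tensorLeft (pauli i) 1 →
      ∀ (a b : Fin 2) (x y : QIdx ℓ),
      ∑ c, pauli i a c * M (qPair c x) (qPair b y) =
      ∑ c, M (qPair a x) (qPair c y) * pauli i c b := by
    intro i hi a b x y
    rw [← tensorLeft_one_mul_apply, ← mul_tensorLeft_one_apply, hi]
  refine ⟨Matrix.of fun x y => M (qPair 0 x) (qPair 0 y), ?_⟩
  ext p q
  obtain ⟨a, x, rfl⟩ := exists_qPair p
  obtain ⟨b, y, rfl⟩ := exists_qPair q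
  rw [tensorLeft_apply, Matrix.of_apply]
  -- Commuting with `Z` kills the off-diagonal blocks; one off-diagonal entry of the relation with
  -- `Y` equates the two diagonal blocks.
  have f01 := e 3 h3 0 1 x y
  have f10 := e 3 h3 1 0 x y
  have g := e 2 h2 1 0 x y
  simp only [Fin.sum_univ_two] at f01 f10 g
  simp [pauli] at f01 f10 g
  fin_cases a <;> fin_cases b
  · simp
  · simpa using self_eq_neg.mp f01
  · simpa using neg_eq_self.mp f10
  · have : M (qPair 1 x) (qPair 1 y) = M (qPair 0 x) (qPair 0 y) := by
      rw [mul_comm] at g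
      exact (mul_right_cancel₀ Complex.I_ne_zero g).symm
    simpa using this

/-- The Clifford matrices act irreducibly: only scalars commute with all of them. -/
theorem eq_smul_one_of_commute_Γ : ∀ (ℓ : ℕ) (M : VOp ℓ), (∀ a, Γ ℓ a * M = M * Γ ℓ a) →
    ∃ z : ℂ, M = z • 1
  | 0, M, _ => by
    refine ⟨M () (), ?_⟩
    ext x y
    have : (1 : VOp 0) x y = 1 := Matrix.one_apply_eq (n := Unit) ()
    rw [Matrix.smul_apply, this, smul_eq_mul, mul_one]
    rfl
  | ℓ + 1, M, h => by
    -- The last two matrices reduce `M` to `1 ⊗ M'`; commuting with `X ⊗ Γ^a` then passes to `M'`.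
    obtain ⟨M', rfl⟩ := eq_tensorLeft_of_commute M (by rw [← Γ_penultimate]; exact h _)
      (by rw [← Γ_last]; exact h _)
    obtain ⟨z, rfl⟩ := eq_smul_one_of_commute_Γ ℓ M' (fun a => by
      have := h (Fin.castSucc (Fin.castSucc a))
      rw [Γ_old, tensorLeft_mul, tensorLeft_mul, one_mul, mul_one] at this
      exact tensorLeft_injective_right (P := pauli 1) (a := 0) (b := 1) (by simp [pauli]) this)
    exact ⟨z, by rw [tensorLeft_smul_right, tensorLeft_one]⟩

/-! ### The product of all Clifford matrices, and the even subalgebra. -/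

theorem prod_map_tensorLeft {ℓ : ℕ} (P : Matrix (Fin 2) (Fin 2) ℂ) (l : List (VOp ℓ)) :
    (l.map (tensorLeft P)).prod = tensorLeft (P ^ l.length) l.prod := by
  induction l with
  | nil => simp [tensorLeft_one]
  | cons M l ih => simp [ih, tensorLeft_mul, pow_succ']

/-- The product of all Clifford matrices is a nonzero scalar. -/
theorem prod_Γ : ∀ ℓ : ℕ, (List.ofFn (Γ ℓ)).prod = (Complex.I ^ ℓ) • (1 : VOp ℓ)
  | 0 => by
    have h : List.ofFn (Γ 0) = [(1 : VOp 0)] := rfl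
    rw [h, pow_zero, one_smul, List.prod_singleton]
  | ℓ + 1 => by
    have hs : List.ofFn (Γ (ℓ + 1)) = ((List.ofFn (Γ ℓ)).map (tensorLeft (pauli 1)) ++
        [tensorLeft (pauli 2) 1]) ++ [tensorLeft (pauli 3) 1] := by
      have e1 : List.ofFn (Γ (ℓ + 1)) =
          List.ofFn (n := 2 * ℓ + 2) (fun i => Γ (ℓ + 1) (Fin.castSucc i)) ++
            [Γ (ℓ + 1) (Fin.last (2 * ℓ + 2))] := List.ofFn_succ_last
      have e2 : List.ofFn (n := 2 * ℓ + 2) (fun i => Γ (ℓ + 1) (Fin.castSucc i)) =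
          List.ofFn (n := 2 * ℓ + 1) (fun i => Γ (ℓ + 1) (Fin.castSucc (Fin.castSucc i))) ++
            [Γ (ℓ + 1) (Fin.castSucc (Fin.last (2 * ℓ + 1)))] := List.ofFn_succ_last
      rw [e1, e2, Γ_last, Γ_penultimate, List.map_ofFn]
      congr 4
      funext i
      exact Γ_old ℓ i
    -- An odd number of factors `X` leaves one `X`, and `XYZ = i` supplies the new factor.
    have hp : pauli 1 ^ (2 * ℓ + 1) = pauli 1 := by
      rw [pow_succ, pow_mul, pow_two, pauli_mul_self, one_pow, one_mul]
    rw [hs, List.prod_append, List.prod_append, prod_map_tensorLeft, List.prod_singleton,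
      List.prod_singleton, List.length_ofFn, hp, prod_Γ ℓ, tensorLeft_mul, tensorLeft_mul,
      pauli_xyz, mul_one, mul_one, tensorLeft_smul_left, tensorLeft_smul_right, tensorLeft_one,
      smul_smul, pow_succ']

/-- The even part of the Clifford algebra already acts irreducibly. -/
theorem eq_smul_one_of_commute_even (ℓ : ℕ) (M : VOp ℓ)
    (h : ∀ a b, a ≠ b → Γ ℓ a * Γ ℓ b * M = M * (Γ ℓ a * Γ ℓ b)) : ∃ z : ℂ, M = z • 1 := by
  -- Moving any `Γ^b` past `M` turns it into `N` and back. The word of all Clifford matrices has odd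
  -- length, so it exchanges `M` and `N`; being a nonzero scalar, it forces `M = N`, which then
  -- commutes with every `Γ^b`.
  set N := Γ ℓ 0 * M * Γ ℓ 0 with hN
  have hΓ : ∀ (b : Site ℓ) (X : VOp ℓ), Γ ℓ b * (Γ ℓ b * X) = X := fun b X => by
    rw [← mul_assoc, Γ_mul_self, one_mul]
  have hb : ∀ b, Γ ℓ b * M = N * Γ ℓ b := by
    intro b
    by_cases hb : (0 : Site ℓ) = b
    · rw [← hb, hN, mul_assoc, Γ_mul_self, mul_one]
    · have := congrArg (fun X => Γ ℓ 0 * X) (h 0 b hb)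
      simp only [mul_assoc, hΓ] at this
      rw [this, hN]
      simp only [mul_assoc]
  have hb' : ∀ b, Γ ℓ b * N = M * Γ ℓ b := by
    intro b
    have := congrArg (fun X => Γ ℓ b * X * Γ ℓ b) (hb b)
    simp only [mul_assoc, hΓ, Γ_mul_self, mul_one] at this
    exact this.symm
  have hl : ∀ l : List (Site ℓ), (l.map (Γ ℓ)).prod * M =
      (if Even l.length then M else N) * (l.map (Γ ℓ)).prod ∧
      (l.map (Γ ℓ)).prod * N = (if Even l.length then N else M) * (l.map (Γ ℓ)).prod := by
    intro l
    induction l with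
    | nil => simp
    | cons b l ih =>
      simp only [List.map_cons, List.prod_cons, List.length_cons, Nat.even_add_one, mul_assoc]
      rw [ih.1, ih.2]
      by_cases he : Even l.length
      · simp only [he, if_true, not_true, if_false]
        rw [← mul_assoc, hb, ← mul_assoc (Γ ℓ b), hb']
        simp only [mul_assoc, and_self]
      · simp only [he, if_false, not_false_iff, if_true]
        rw [← mul_assoc, hb', ← mul_assoc (Γ ℓ b), hb]
        simp only [mul_assoc, and_self]
  have := (hl (List.ofFn id)).1
  rw [List.map_ofFn, Function.comp_id, prod_Γ, List.length_ofFn,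
    if_neg (Nat.not_even_iff_odd.mpr ⟨ℓ, rfl⟩), smul_mul_assoc, one_mul, mul_smul_comm,
    mul_one] at this
  have hMN : M = N := by
    have hI : Complex.I ^ ℓ ≠ 0 := pow_ne_zero _ Complex.I_ne_zero
    exact smul_right_injective _ hI this
  exact eq_smul_one_of_commute_Γ ℓ M fun a => by rw [hb, ← hMN]

/-! ### Pauli strings -/

theorem pauliString_succ {ℓ : ℕ} (p : Fin (ℓ + 1) → Fin 4) :
    pauliString (ℓ + 1) p = tensorLeft (pauli (p 0)) (pauliString ℓ (Fin.tail p)) := rfl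

theorem pauliString_cons {ℓ : ℕ} (q : Fin 4) (p : Fin ℓ → Fin 4) :
    pauliString (ℓ + 1) (Fin.cons q p) = tensorLeft (pauli q) (pauliString ℓ p) := by
  rw [pauliString_succ, Fin.cons_zero, Fin.tail_cons]

theorem pauliString_zero : ∀ ℓ : ℕ, pauliString ℓ (fun _ => 0) = 1
  | 0 => rfl
  | ℓ + 1 => by
    rw [pauliString_succ, pauli_zero]
    exact (congrArg (tensorLeft 1) (pauliString_zero ℓ)).trans tensorLeft_one

theorem Γ_eq_pauliString : ∀ (ℓ : ℕ) (a : Site ℓ), ∃ p : Fin ℓ → Fin 4, Γ ℓ a = pauliString ℓ p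
  | 0, _ => ⟨fun _ => 0, rfl⟩
  | ℓ + 1, a => by
    revert a
    refine forall_site_succ (fun i => ?_) ?_ ?_
    · obtain ⟨p, hp⟩ := Γ_eq_pauliString ℓ i
      exact ⟨Fin.cons 1 p, by rw [Γ_old, pauliString_cons, hp]⟩
    · exact ⟨Fin.cons 2 fun _ => 0, by rw [Γ_penultimate, pauliString_cons, pauliString_zero]⟩
    · exact ⟨Fin.cons 3 fun _ => 0, by rw [Γ_last, pauliString_cons, pauliString_zero]⟩

theorem pauliString_mul : ∀ (ℓ : ℕ) (p q : Fin ℓ → Fin 4), ∃ (z : ℂ) (r : Fin ℓ → Fin 4),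
    z ^ 4 = 1 ∧ pauliString ℓ p * pauliString ℓ q = z • pauliString ℓ r
  | 0, _, _ => ⟨1, fun _ => 0, one_pow _, by
      rw [one_smul]; exact Matrix.mul_one (1 : Matrix Unit Unit ℂ)⟩
  | ℓ + 1, p, q => by
    obtain ⟨z, r, hz, hr⟩ := pauliString_mul ℓ (Fin.tail p) (Fin.tail q)
    obtain ⟨y, k, hy, hk⟩ := exists_pauli_mul (p 0) (q 0)
    refine ⟨y * z, Fin.cons k r, by rw [mul_pow, hy, hz, mul_one], ?_⟩
    rw [pauliString_succ, pauliString_succ, tensorLeft_mul, hr, hk, tensorLeft_smul_left,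
      tensorLeft_smul_right, pauliString_cons, smul_smul]

theorem byproduct_eq_smul_pauliString (ℓ : ℕ) {B : VOp ℓ} (hB : B ∈ byproducts ℓ) :
    ∃ (z : ℂ) (p : Fin ℓ → Fin 4), z ^ 4 = 1 ∧ B = z • pauliString ℓ p := by
  induction hB using Submonoid.closure_induction with
  | mem B hB =>
    obtain ⟨a, rfl⟩ := hB
    obtain ⟨p, hp⟩ := Γ_eq_pauliString ℓ a
    exact ⟨1, p, one_pow _, by rw [one_smul, hp]⟩
  | one => exact ⟨1, fun _ => 0, one_pow _, by rw [one_smul, pauliString_zero]⟩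
  | mul B C _ _ hB hC =>
    obtain ⟨z, p, hz, rfl⟩ := hB
    obtain ⟨y, q, hy, rfl⟩ := hC
    obtain ⟨x, r, hx, hr⟩ := pauliString_mul ℓ p q
    refine ⟨z * y * x, r, by rw [mul_pow, mul_pow, hx, hy, hz]; norm_num, ?_⟩
    rw [smul_mul_smul_comm, hr, smul_smul]

/-! ### The one-parameter groups `exp(-iθ Γ^{ab})` -/

theorem Γ_mul_Γ_sq (ℓ : ℕ) {a b : Site ℓ} (h : a ≠ b) :
    (Γ ℓ a * Γ ℓ b) * (Γ ℓ a * Γ ℓ b) = -1 := by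
  calc (Γ ℓ a * Γ ℓ b) * (Γ ℓ a * Γ ℓ b) = Γ ℓ a * (Γ ℓ b * Γ ℓ a) * Γ ℓ b := by
        simp only [mul_assoc]
    _ = -((Γ ℓ a * Γ ℓ a) * (Γ ℓ b * Γ ℓ b)) := by
        rw [Γ_anticomm ℓ h.symm]; simp only [mul_neg, neg_mul, mul_assoc]
    _ = -1 := by rw [Γ_mul_self, Γ_mul_self, mul_one]

theorem gen_eq (ℓ : ℕ) {a b : Site ℓ} (h : a ≠ b) :
    gen ℓ a b = (-Complex.I) • (Γ ℓ a * Γ ℓ b) := by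
  rw [gen, Γ_anticomm ℓ h.symm, sub_neg_eq_add, ← two_smul ℂ, smul_smul]
  congr 1
  have := Complex.I_ne_zero
  field_simp
  rw [Complex.I_sq, neg_neg]

theorem map_exp_of_complex {A : Type*} [Ring A] [TopologicalSpace A] [IsTopologicalRing A]
    [T2Space A] [Algebra ℚ A] (f : ℂ →+* A) (hf : Continuous f) (z : ℂ) :
    f (NormedSpace.exp z) = NormedSpace.exp (f z) := by
  rw [NormedSpace.exp_eq_tsum ℚ, NormedSpace.exp_eq_tsum ℚ]
  refine ((NormedSpace.expSeries_summable' (𝕂 := ℚ) z).map_tsum f hf).trans ?_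
  simp_rw [map_inv_natCast_smul f ℚ ℚ, map_pow]

/-- Euler's formula: `Γ^a Γ^b` squares to `-1`, so it is the image of `i` under an algebra map from
`ℂ`, and the exponent is the image of `-iθ`. -/
theorem rot_eq (ℓ : ℕ) {a b : Site ℓ} (h : a ≠ b) (θ : ℝ) :
    rot ℓ a b θ = (Real.cos θ : ℂ) • (1 : VOp ℓ) - (Real.sin θ : ℂ) • (Γ ℓ a * Γ ℓ b) := by
  set J := Γ ℓ a * Γ ℓ b with hJ
  let f : ℂ →ₐ[ℝ] VOp ℓ := Complex.lift ⟨J, Γ_mul_Γ_sq ℓ h⟩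
  have hf : ∀ z : ℂ, f z = (z.re : ℂ) • (1 : VOp ℓ) + (z.im : ℂ) • J := by
    intro z
    have : f z = algebraMap ℝ (VOp ℓ) z.re + z.im • J := rfl
    rw [this, Algebra.algebraMap_eq_smul_one, Complex.coe_smul, Complex.coe_smul]
  have hc : Continuous f := by
    exact LinearMap.continuous_of_finiteDimensional f.toLinearMap
  have h1 : (-(Complex.I * (θ : ℂ))) • gen ℓ a b = f ((-θ : ℝ) * Complex.I) := by
    rw [gen_eq ℓ h, hf, smul_smul]
    have : -(Complex.I * (θ : ℂ)) * -Complex.I = (-θ : ℝ) := by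
      linear_combination (θ : ℂ) * Complex.I_sq + (by push_cast; ring : (-θ : ℂ) = ((-θ : ℝ) : ℂ))
    rw [this]
    simp [hJ]
  have h2 : NormedSpace.exp (f ((-θ : ℝ) * Complex.I)) = f (NormedSpace.exp ((-θ : ℝ) * Complex.I)) :=
    (map_exp_of_complex f.toRingHom hc _).symm
  rw [rot, h1, h2, hf, ← Complex.exp_eq_exp_ℂ, Complex.exp_ofReal_mul_I_re,
    Complex.exp_ofReal_mul_I_im, Real.cos_neg, Real.sin_neg, Complex.ofReal_neg, neg_smul,
    sub_eq_add_neg]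

theorem rot_zero (ℓ : ℕ) {a b : Site ℓ} (h : a ≠ b) : rot ℓ a b 0 = 1 := by
  simp [rot_eq ℓ h]

theorem rot_mul_rot (ℓ : ℕ) {a b : Site ℓ} (h : a ≠ b) (θ φ : ℝ) :
    rot ℓ a b θ * rot ℓ a b φ = rot ℓ a b (θ + φ) := by
  simp only [rot_eq ℓ h, Real.cos_add, Real.sin_add, sub_mul, mul_sub, smul_mul_smul_comm,
    Γ_mul_Γ_sq ℓ h, mul_one, one_mul, Complex.ofReal_add, Complex.ofReal_sub, Complex.ofReal_mul]
  module

theorem rot_conjTranspose (ℓ : ℕ) {a b : Site ℓ} (h : a ≠ b) (θ : ℝ) :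
    (rot ℓ a b θ)ᴴ = rot ℓ a b (-θ) := by
  rw [rot_eq ℓ h, rot_eq ℓ h, conjTranspose_sub, conjTranspose_smul, conjTranspose_smul,
    conjTranspose_one, conjTranspose_mul, Γ_conjTranspose, Γ_conjTranspose, Γ_anticomm ℓ h.symm,
    Real.cos_neg, Real.sin_neg, Complex.star_def, Complex.conj_ofReal,
    Complex.conj_ofReal, smul_neg, Complex.ofReal_neg, neg_smul]

theorem rot_conjTranspose_mul_self (ℓ : ℕ) {a b : Site ℓ} (h : a ≠ b) (θ : ℝ) :
    (rot ℓ a b θ)ᴴ * rot ℓ a b θ = 1 := by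
  rw [rot_conjTranspose ℓ h, rot_mul_rot ℓ h, neg_add_cancel, rot_zero ℓ h]

theorem Γ_mul_pair_of_mem (ℓ : ℕ) {a b j : Site ℓ} (h : a ≠ b) (hj : j = a ∨ j = b) :
    Γ ℓ j * (Γ ℓ a * Γ ℓ b) = -((Γ ℓ a * Γ ℓ b) * Γ ℓ j) := by
  rcases hj with rfl | rfl
  · rw [mul_assoc, Γ_anticomm ℓ h.symm, mul_neg, neg_neg]
  · rw [← mul_assoc, Γ_anticomm ℓ h.symm, neg_mul]

theorem Γ_mul_pair_of_notMem (ℓ : ℕ) {a b j : Site ℓ} (ha : j ≠ a) (hb : j ≠ b) :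
    Γ ℓ j * (Γ ℓ a * Γ ℓ b) = (Γ ℓ a * Γ ℓ b) * Γ ℓ j := by
  rw [← mul_assoc, Γ_anticomm ℓ ha, neg_mul, mul_assoc, Γ_anticomm ℓ hb, mul_neg, neg_neg,
    mul_assoc]

theorem Γ_mul_rot_of_mem (ℓ : ℕ) {a b j : Site ℓ} (h : a ≠ b) (hj : j = a ∨ j = b) (θ : ℝ) :
    Γ ℓ j * rot ℓ a b θ = rot ℓ a b (-θ) * Γ ℓ j := by
  rw [rot_eq ℓ h, rot_eq ℓ h, mul_sub, sub_mul, mul_smul_comm, mul_smul_comm,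
    Γ_mul_pair_of_mem ℓ h hj, Real.cos_neg, Real.sin_neg]
  simp

theorem Γ_mul_rot_of_notMem (ℓ : ℕ) {a b j : Site ℓ} (h : a ≠ b) (ha : j ≠ a) (hb : j ≠ b)
    (θ : ℝ) : Γ ℓ j * rot ℓ a b θ = rot ℓ a b θ * Γ ℓ j := by
  rw [rot_eq ℓ h, mul_sub, sub_mul, mul_smul_comm, mul_smul_comm, Γ_mul_pair_of_notMem ℓ ha hb]
  simp

/-- Passing `Γ^j` through a gate reverses its angle, so the two outer factors add up instead of
cancelling. This doubling is the source of all half angles below. -/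
theorem rot_conj_Γ_of_mem (ℓ : ℕ) {a b j : Site ℓ} (h : a ≠ b) (hj : j = a ∨ j = b) (θ : ℝ) :
    (rot ℓ a b θ)ᴴ * Γ ℓ j * rot ℓ a b θ = Γ ℓ j * rot ℓ a b (2 * θ) := by
  rw [rot_conjTranspose ℓ h, ← Γ_mul_rot_of_mem ℓ h hj, mul_assoc, rot_mul_rot ℓ h, two_mul]

theorem rot_conj_Γ_of_notMem (ℓ : ℕ) {a b j : Site ℓ} (h : a ≠ b) (ha : j ≠ a) (hb : j ≠ b)
    (θ : ℝ) : (rot ℓ a b θ)ᴴ * Γ ℓ j * rot ℓ a b θ = Γ ℓ j := by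
  rw [mul_assoc, Γ_mul_rot_of_notMem ℓ h ha hb, ← mul_assoc, rot_conjTranspose_mul_self ℓ h,
    one_mul]

/-! ### Covering rotations -/

theorem covers_one (ℓ : ℕ) : Covers ℓ 1 1 := by
  intro i
  simp [Matrix.one_apply]

theorem Covers.mul {ℓ : ℕ} {V V' : VOp ℓ} {R R' : Matrix (Site ℓ) (Site ℓ) ℝ}
    (h : Covers ℓ V R) (h' : Covers ℓ V' R') : Covers ℓ (V * V') (R * R') := by
  intro i
  calc (V * V')ᴴ * Γ ℓ i * (V * V') = V'ᴴ * (Vᴴ * Γ ℓ i * V) * V' := by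
        rw [conjTranspose_mul]; simp only [mul_assoc]
    _ = ∑ k, (R i k : ℂ) • (V'ᴴ * Γ ℓ k * V') := by
        rw [h i]; simp [Finset.mul_sum, Finset.sum_mul]
    _ = ∑ j, ((R * R') i j : ℂ) • Γ ℓ j := by
        simp only [h' _, Finset.smul_sum, smul_smul, Matrix.mul_apply, Complex.ofReal_sum,
          Complex.ofReal_mul, Finset.sum_smul]
        exact Finset.sum_comm

theorem Covers.eq {ℓ : ℕ} {V : VOp ℓ} {R R' : Matrix (Site ℓ) (Site ℓ) ℝ}
    (h : Covers ℓ V R) (h' : Covers ℓ V R') : R = R' := by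
  ext i j
  have := congrFun (sum_smul_Γ_injective ℓ ((h i).symm.trans (h' i))) j
  exact_mod_cast this

theorem Covers.smul {ℓ : ℕ} {V : VOp ℓ} {R : Matrix (Site ℓ) (Site ℓ) ℝ}
    (h : Covers ℓ V R) {z : ℂ} (hz : ‖z‖ = 1) : Covers ℓ (z • V) R := by
  intro i
  have hzz : star z * z = 1 := by
    rw [Complex.star_def, Complex.conj_mul', hz]; norm_num
  rw [conjTranspose_smul, smul_mul_assoc, smul_mul_smul_comm, hzz, one_smul, h i]

/-- Conjugation by a unitary preserves anticommutators, and these encode the Euclidean inner product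
of coefficient vectors. -/
theorem Covers.mem_orthogonalGroup {ℓ : ℕ} {V : VOp ℓ} {R : Matrix (Site ℓ) (Site ℓ) ℝ}
    (hV : Vᴴ * V = 1) (h : Covers ℓ V R) : R ∈ Matrix.orthogonalGroup (Site ℓ) ℝ := by
  have hV' : V * Vᴴ = 1 := mul_eq_one_comm.mp hV
  rw [Matrix.mem_orthogonalGroup_iff]
  ext i j
  have h1 := sum_smul_Γ_anticommutator ℓ (fun k => (R i k : ℂ)) (fun k => (R j k : ℂ))
  rw [← h i, ← h j] at h1
  have h2 : ∀ i j, (Vᴴ * Γ ℓ i * V) * (Vᴴ * Γ ℓ j * V) = Vᴴ * (Γ ℓ i * Γ ℓ j) * V := by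
    intro i j
    calc _ = Vᴴ * Γ ℓ i * (V * Vᴴ) * Γ ℓ j * V := by simp only [mul_assoc]
      _ = _ := by rw [hV', mul_one]; simp only [mul_assoc]
  rw [h2, h2, ← add_mul, ← mul_add, Γ_anticommutator] at h1
  have h3 : (if i = j then (2 : ℂ) else 0) • (1 : VOp ℓ) =
      (2 * ∑ k, (R i k : ℂ) * (R j k : ℂ)) • (1 : VOp ℓ) := by
    rw [← h1]
    split_ifs <;> simp [hV]
  have h4 := congrArg Matrix.trace h3
  rw [Matrix.trace_smul, Matrix.trace_smul, trace_one_vOp, smul_eq_mul, smul_eq_mul] at h4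
  have h5 := mul_right_cancel₀ (two_pow_ne_zero_complex ℓ) h4
  rw [Matrix.mul_apply, Matrix.one_apply]
  simp only [Matrix.transpose_apply]
  have h6 : (2 : ℂ) * ((∑ k, R i k * R j k : ℝ) : ℂ) = 2 * ((if i = j then 1 else 0 : ℝ) : ℂ) := by
    push_cast
    rw [← h5]
    split_ifs <;> simp
  exact_mod_cast mul_left_cancel₀ two_ne_zero h6

/-- The rotation by the angle `t` in the coordinate plane `(a, b)`. -/
def givens {n : ℕ} (a b : Fin n) (t : ℝ) : Matrix (Fin n) (Fin n) ℝ :=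
  Matrix.of fun i j =>
    if i = a then (if j = a then Real.cos t else if j = b then -Real.sin t else 0)
    else if i = b then (if j = a then Real.sin t else if j = b then Real.cos t else 0)
    else if i = j then 1 else 0

theorem covers_rot (ℓ : ℕ) {a b : Site ℓ} (h : a ≠ b) (θ : ℝ) :
    Covers ℓ (rot ℓ a b θ) (givens a b (2 * θ)) := by
  have key : ∀ f : Site ℓ → VOp ℓ, (∀ j, j ≠ a → j ≠ b → f j = 0) → ∑ j, f j = f a + f b := by
    intro f hf
    exact Finset.sum_eq_add a b h (fun j _ hj => hf j hj.1 hj.2) (by simp) (by simp)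
  intro i
  by_cases ha : i = a
  · subst ha
    rw [rot_conj_Γ_of_mem ℓ h (Or.inl rfl), key _ (by intro j h1 h2; simp [givens, h1, h2]),
      rot_eq ℓ h, mul_sub, mul_smul_comm, mul_smul_comm, ← mul_assoc, Γ_mul_self]
    simp [givens, h.symm, sub_eq_add_neg]
  by_cases hb : i = b
  · subst hb
    rw [rot_conj_Γ_of_mem ℓ h (Or.inr rfl), key _ (by intro j h1 h2; simp [givens, h1, h2]),
      rot_eq ℓ h, mul_sub, mul_smul_comm, mul_smul_comm, Γ_mul_pair_of_mem ℓ h (Or.inr rfl),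
      mul_assoc, Γ_mul_self]
    simp [givens, h.symm, add_comm]
  · rw [rot_conj_Γ_of_notMem ℓ h ha hb]
    simp [givens, ha, hb]

/-- Orthogonality comes from being covered. The determinant is then `±1`, and it is nonnegative
because the matrix is the square of the rotation by half the angle. -/
theorem givens_mem (ℓ : ℕ) {a b : Site ℓ} (h : a ≠ b) (t : ℝ) :
    givens a b t ∈ Matrix.specialOrthogonalGroup (Site ℓ) ℝ := by
  have hc := covers_rot ℓ h (t / 2)
  rw [mul_div_cancel₀ _ two_ne_zero] at hc
  have ho := hc.mem_orthogonalGroup (rot_conjTranspose_mul_self ℓ h _)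
  have hh : givens a b t = givens a b (t / 2) * givens a b (t / 2) := by
    refine hc.eq ?_
    have h4 := covers_rot ℓ h (t / 4)
    have h5 := h4.mul h4
    rw [rot_mul_rot ℓ h] at h5
    convert h5 using 2 <;> ring_nf
  rw [Matrix.mem_specialOrthogonalGroup_iff]
  refine ⟨ho, ?_⟩
  have h1 : (givens a b t).det * (givens a b t).det = 1 := by
    have := congrArg Matrix.det ((Matrix.mem_orthogonalGroup_iff _ _).mp ho)
    rwa [Matrix.det_mul, Matrix.det_transpose, Matrix.det_one] at this
  have h2 : 0 ≤ (givens a b t).det := by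
    rw [hh, Matrix.det_mul]; exact mul_self_nonneg _
  nlinarith

theorem rot_mem_spinGates (ℓ : ℕ) {a b : Site ℓ} (h : a ≠ b) (θ : ℝ) :
    rot ℓ a b θ ∈ spinGates ℓ :=
  Submonoid.subset_closure ⟨a, b, h, θ, rfl⟩

theorem spinGates_conjTranspose_mul_self {ℓ : ℕ} {V : VOp ℓ} (hV : V ∈ spinGates ℓ) :
    Vᴴ * V = 1 := by
  induction hV using Submonoid.closure_induction with
  | mem V hV =>
    obtain ⟨a, b, h, θ, rfl⟩ := hV
    exact rot_conjTranspose_mul_self ℓ h θ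
  | one => simp
  | mul V V' _ _ h h' =>
    rw [conjTranspose_mul, mul_assoc, ← mul_assoc Vᴴ, h, one_mul, h']

theorem spinGates_mem_unitaryGroup {ℓ : ℕ} {V : VOp ℓ} (hV : V ∈ spinGates ℓ) :
    V ∈ Matrix.unitaryGroup (QIdx ℓ) ℂ :=
  Matrix.mem_unitaryGroup_iff'.mpr (spinGates_conjTranspose_mul_self hV)

theorem exists_covers_of_mem_spinGates {ℓ : ℕ} {V : VOp ℓ} (hV : V ∈ spinGates ℓ) :
    ∃ R ∈ Matrix.specialOrthogonalGroup (Site ℓ) ℝ, Covers ℓ V R := by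
  induction hV using Submonoid.closure_induction with
  | mem V hV =>
    obtain ⟨a, b, h, θ, rfl⟩ := hV
    exact ⟨_, givens_mem ℓ h _, covers_rot ℓ h θ⟩
  | one => exact ⟨1, one_mem _, covers_one ℓ⟩
  | mul V V' _ _ h h' =>
    obtain ⟨R, hR, h⟩ := h
    obtain ⟨R', hR', h'⟩ := h'
    exact ⟨R * R', mul_mem hR hR', h.mul h'⟩

/-! ### Measurements -/

theorem Covers.measBasis_eq {ℓ : ℕ} {V : VOp ℓ} {R : Matrix (Site ℓ) (Site ℓ) ℝ}
    (h : Covers ℓ V R) : measBasis ℓ V = R.map (fun x : ℝ => (x : ℂ)) := by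
  ext i j
  have : Matrix.trace (Γ ℓ i * V * Γ ℓ j * Vᴴ) = Matrix.trace (Vᴴ * Γ ℓ i * V * Γ ℓ j) := by
    rw [Matrix.trace_mul_comm]; simp only [mul_assoc]
  rw [measBasis, Matrix.of_apply, this, h i, trace_sum_smul_Γ_mul,
    mul_div_cancel_right₀ _ (two_pow_ne_zero_complex ℓ), Matrix.map_apply]

theorem Covers.sum_measBasis_smul {ℓ : ℕ} {V : VOp ℓ} {R : Matrix (Site ℓ) (Site ℓ) ℝ}
    (h : Covers ℓ V R) (i : Site ℓ) : ∑ j, measBasis ℓ V i j • Γ ℓ j = Vᴴ * Γ ℓ i * V := by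
  rw [h.measBasis_eq, h i]; rfl

theorem map_ofReal_mem_unitaryGroup {n : Type*} [Fintype n] [DecidableEq n] {R : Matrix n n ℝ}
    (h : R ∈ Matrix.orthogonalGroup n ℝ) :
    R.map (fun x : ℝ => (x : ℂ)) ∈ Matrix.unitaryGroup n ℂ := by
  rw [Matrix.mem_unitaryGroup_iff]
  have h1 := congrArg (fun M : Matrix n n ℝ => M.map (Complex.ofRealHom)) ((Matrix.mem_orthogonalGroup_iff _ _).mp h)
  simp only [Matrix.map_mul, Matrix.map_one _ Complex.ofRealHom.map_zero
    Complex.ofRealHom.map_one] at h1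
  rw [← h1]
  congr 1
  ext i j
  simp [Matrix.star_apply]

theorem measBasis_mem_unitaryGroup {ℓ : ℕ} {V : VOp ℓ} (hV : V ∈ spinGates ℓ) :
    measBasis ℓ V ∈ Matrix.unitaryGroup (Site ℓ) ℂ := by
  obtain ⟨R, hR, h⟩ := exists_covers_of_mem_spinGates hV
  rw [h.measBasis_eq]
  exact map_ofReal_mem_unitaryGroup (Matrix.mem_specialOrthogonalGroup_iff.mp hR).1

/-- Multilinear expansion of an ordered product of sums. -/
theorem sum_prod_smul_list_prod {ι A : Type*} [Fintype ι] [Ring A] [Algebra ℂ A]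
    (f : ι → A) : ∀ (N : ℕ) (w : Fin N → ι → ℂ),
    ∑ i : Fin N → ι, (∏ k, w k (i k)) • (List.ofFn fun k => f (i k)).prod =
      (List.ofFn fun k => ∑ j, w k j • f j).prod
  | 0, w => by simp
  | N + 1, w => by
    rw [← (Fin.consEquiv fun _ : Fin (N + 1) => ι).sum_comp, Fintype.sum_prod_type,
      List.ofFn_succ, List.prod_cons, ← sum_prod_smul_list_prod f N, Finset.sum_mul_sum]
    refine Finset.sum_congr rfl fun j _ => Finset.sum_congr rfl fun i _ => ?_
    simp [Fin.consEquiv, Fin.prod_univ_succ, List.ofFn_succ, smul_smul, mul_comm]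

/-- Once the record `s` is given, all adaptive bases are determined, and the sum over spin
configurations factors site by site: site `k` contributes the vector whose coefficients are the
measured row. -/
theorem postState_eq {ℓ N : ℕ} (W : List (Site ℓ) → Matrix (Site ℓ) (Site ℓ) ℂ)
    (s : Fin N → Site ℓ) (L : QIdx ℓ → ℂ) :
    postState W s L =
      ((((Real.sqrt (2 * ℓ + 1))⁻¹ : ℝ) : ℂ) ^ N) •
        ((List.ofFn fun k => ∑ j, W (history s k) (s k) j • Γ ℓ j).prod *ᵥ L) := by
  set r : ℂ := (((Real.sqrt (2 * ℓ + 1))⁻¹ : ℝ) : ℂ) with hr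
  have hk : ∀ (M : ℕ) (i : Fin M → Site ℓ), (List.ofFn fun k => kraus ℓ (i k)).prod =
      r ^ M • (List.ofFn fun k => Γ ℓ (i k)).prod := by
    intro M
    induction M with
    | zero => simp
    | succ M ih =>
      intro i
      rw [List.ofFn_succ, List.prod_cons, ih, List.ofFn_succ, List.prod_cons, kraus,
        smul_mul_smul_comm, ← hr, pow_succ']
  rw [← sum_prod_smul_list_prod (Γ ℓ) N (fun k => W (history s k) (s k)), Matrix.sum_mulVec,
    Finset.smul_sum, postState]
  refine Finset.sum_congr rfl fun i _ => ?_
  rw [akltState, hk, Matrix.smul_mulVec, Matrix.smul_mulVec, smul_comm]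

theorem postState_measBasis {ℓ N : ℕ} {V : List (Site ℓ) → VOp ℓ} (hV : ∀ h, V h ∈ spinGates ℓ)
    (s : Fin N → Site ℓ) (L : QIdx ℓ → ℂ) :
    postState (fun h => measBasis ℓ (V h)) s L =
      ((((Real.sqrt (2 * ℓ + 1))⁻¹ : ℝ) : ℂ) ^ N) •
        ((List.ofFn fun k =>
          (V (history s k))ᴴ * Γ ℓ (s k) * V (history s k)).prod *ᵥ L) := by
  rw [postState_eq]
  congr 4
  funext k
  obtain ⟨R, -, h⟩ := exists_covers_of_mem_spinGates (hV (history s k))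
  exact h.sum_measBasis_smul _

/-! ### Norms and outcome probabilities. -/

theorem normSq_eq_dotProduct {ℓ : ℕ} (ψ : QIdx ℓ → ℂ) : ((normSq ψ : ℝ) : ℂ) = star ψ ⬝ᵥ ψ := by
  simp [normSq, dotProduct, Complex.conj_mul']

theorem normSq_mulVec {ℓ : ℕ} {U : VOp ℓ} (hU : Uᴴ * U = 1) (ψ : QIdx ℓ → ℂ) :
    normSq (U *ᵥ ψ) = normSq ψ := by
  have : ((normSq (U *ᵥ ψ) : ℝ) : ℂ) = (normSq ψ : ℝ) := by
    rw [normSq_eq_dotProduct, normSq_eq_dotProduct, Matrix.star_mulVec, Matrix.dotProduct_mulVec,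
      Matrix.vecMul_vecMul, hU, Matrix.vecMul_one]
  exact_mod_cast this

theorem normSq_smul {ℓ : ℕ} (c : ℂ) (ψ : QIdx ℓ → ℂ) :
    normSq (c • ψ) = ‖c‖ ^ 2 * normSq ψ := by
  simp [normSq, mul_pow, Finset.mul_sum]

theorem conj_Γ_conjTranspose_mul_self {ℓ : ℕ} {V : VOp ℓ} (hV : V ∈ spinGates ℓ) (j : Site ℓ) :
    (Vᴴ * Γ ℓ j * V)ᴴ * (Vᴴ * Γ ℓ j * V) = 1 := by
  have h := spinGates_conjTranspose_mul_self hV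
  have h' : V * Vᴴ = 1 := mul_eq_one_comm.mp h
  rw [conjTranspose_mul, conjTranspose_mul, conjTranspose_conjTranspose, Γ_conjTranspose]
  calc _ = Vᴴ * (Γ ℓ j * (V * Vᴴ) * Γ ℓ j) * V := by simp only [mul_assoc]
    _ = 1 := by rw [h', mul_one, Γ_mul_self, mul_one, h]

theorem list_prod_conjTranspose_mul_self {ℓ : ℕ} (l : List (VOp ℓ))
    (h : ∀ M ∈ l, Mᴴ * M = 1) : l.prodᴴ * l.prod = 1 := by
  induction l with
  | nil => simp
  | cons M l ih =>
    have h1 := h M (by simp)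
    have h2 := ih fun X hX => h X (by simp [hX])
    rw [List.prod_cons, conjTranspose_mul, mul_assoc, ← mul_assoc Mᴴ, h1, one_mul, h2]

/-- The inserted operators are unitary, so only the scalar prefactor affects the norm. -/
theorem outcomeProb_measBasis {ℓ N : ℕ} {V : List (Site ℓ) → VOp ℓ}
    (hV : ∀ h, V h ∈ spinGates ℓ) (s : Fin N → Site ℓ) {L : QIdx ℓ → ℂ} (hL : normSq L = 1) :
    outcomeProb (fun h => measBasis ℓ (V h)) s L = (1 / (2 * (ℓ : ℝ) + 1)) ^ N := by
  rw [outcomeProb, postState_measBasis hV, normSq_smul, normSq_mulVec, hL, mul_one, norm_pow,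
    ← pow_mul, mul_comm N, pow_mul, Complex.norm_real, Real.norm_eq_abs, sq_abs, inv_pow,
    Real.sq_sqrt (by positivity), one_div]
  refine list_prod_conjTranspose_mul_self _ fun M hM => ?_
  obtain ⟨k, rfl⟩ := (List.mem_ofFn' _ _).mp hM
  exact conj_Γ_conjTranspose_mul_self (hV _) _

/-! ### Decomposition of rotations into plane rotations -/

theorem givens_mulVec_apply {n : ℕ} {a b : Fin n} (h : a ≠ b) (t : ℝ) (v : Fin n → ℝ) (i : Fin n) :
    (givens a b t *ᵥ v) i =
      if i = a then Real.cos t * v a - Real.sin t * v b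
      else if i = b then Real.sin t * v a + Real.cos t * v b else v i := by
  have key : ∀ f : Fin n → ℝ, (∀ j, j ≠ a → j ≠ b → f j = 0) → ∑ j, f j = f a + f b := by
    intro f hf
    exact Finset.sum_eq_add a b h (fun j _ hj => hf j hj.1 hj.2) (by simp) (by simp)
  rw [Matrix.mulVec, dotProduct]
  by_cases ha : i = a
  · rw [key _ (by intro j h1 h2; simp [givens, ha, h1, h2])]
    simp [givens, ha, h.symm, sub_eq_add_neg]
  by_cases hb : i = b
  · rw [key _ (by intro j h1 h2; simp [givens, hb, h.symm, h1, h2])]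
    simp [givens, hb, h.symm]
  · simp [givens, ha, hb]

theorem exists_polar (x y : ℝ) :
    ∃ r t : ℝ, 0 ≤ r ∧ x = Real.cos t * r ∧ y = Real.sin t * r := by
  refine ⟨‖(⟨x, y⟩ : ℂ)‖, Complex.arg ⟨x, y⟩, norm_nonneg _, ?_, ?_⟩
  · rw [mul_comm, Complex.norm_mul_cos_arg]
  · rw [mul_comm, Complex.norm_mul_sin_arg]

/-- A product of plane rotations that involve the axis `m` takes a multiple of this axis to any
given vector. -/
theorem exists_givens_prod_mulVec {n : ℕ} (m : Fin n) (l : List (Fin n)) (hm : m ∉ l)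
    (hl : l.Nodup) (v : Fin n → ℝ) (hv : ∀ i, i ≠ m → i ∉ l → v i = 0) :
    ∃ (t : Fin n → ℝ) (c : ℝ), (l ≠ [] → 0 ≤ c) ∧
      v = (l.map fun b => givens m b (t b)).prod *ᵥ Pi.single m c := by
  induction l generalizing v with
  | nil =>
    refine ⟨fun _ => 0, v m, by simp, ?_⟩
    ext i
    by_cases hi : i = m
    · simp [hi]
    · simp [hi, hv i hi]
  | cons b l ih =>
    rw [List.mem_cons, not_or] at hm
    rw [List.nodup_cons] at hl
    -- Polar coordinates in the plane `(m, b)`: `v` is the rotation by `t` of a vector with entry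
    -- `0` at `b` and `r ≥ 0` at `m`.
    obtain ⟨r, t, hr, hx, hy⟩ := exists_polar (v m) (v b)
    obtain ⟨t', c, hc, h⟩ := ih hm.2 hl.2 (fun i => if i = m then r else if i = b then 0 else v i) (by
      intro i h1 h2
      by_cases hb : i = b
      · simp [hb, Ne.symm hm.1]
      · simp only [h1, hb, if_false]
        exact hv i h1 (by simp [hb, h2]))
    -- If `b` was the only remaining axis, the induction hypothesis gives no sign, but then `c` is
    -- the radius `r`.
    have hc' : 0 ≤ c := by
      by_cases hl' : l = []
      · subst hl'
        have := congrFun h m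
        simp only [if_true, List.map_nil, List.prod_nil, Matrix.one_mulVec, Pi.single_eq_same] at this
        rwa [← this]
      · exact hc hl'
    refine ⟨Function.update t' b t, c, fun _ => hc', ?_⟩
    have hmap : (l.map fun x => givens m x (Function.update t' b t x)) =
        l.map fun x => givens m x (t' x) := by
      refine List.map_congr_left fun x hx => ?_
      have : x ≠ b := fun e => hl.1 (e ▸ hx)
      rw [Function.update_of_ne this]
    rw [List.map_cons, List.prod_cons, hmap, ← Matrix.mulVec_mulVec, ← h, Function.update_self]
    ext i
    rw [givens_mulVec_apply hm.1]
    by_cases h1 : i = m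
    · simp [h1, Ne.symm hm.1, hx]
    by_cases h2 : i = b
    · simp [h2, Ne.symm hm.1, hy]
    · simp [h1, h2]

/-- The product of the plane rotations in the planes `(a, b)` with `b > a`. -/
def givensRow {n : ℕ} (a : Fin n) (t : Fin n → ℝ) : Matrix (Fin n) (Fin n) ℝ :=
  (((List.finRange n).filter fun b => a < b).map fun b => givens a b (t b)).prod

theorem givensRow_mem (ℓ : ℕ) (a : Site ℓ) (t : Site ℓ → ℝ) :
    givensRow a t ∈ Matrix.specialOrthogonalGroup (Site ℓ) ℝ := by
  refine Submonoid.list_prod_mem _ fun M hM => ?_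
  obtain ⟨b, hb, rfl⟩ := List.mem_map.mp hM
  exact givens_mem ℓ (by simpa using (List.mem_filter.mp hb).2 : a < b).ne _

/-- The planes of row `a` contain no earlier axis, so clearing a column does not disturb the axes
already fixed. -/
theorem givensRow_mulVec_single {n : ℕ} {a i : Fin n} (h : i < a) (t : Fin n → ℝ) :
    givensRow a t *ᵥ Pi.single i 1 = Pi.single i 1 := by
  have : ∀ l : List (Fin n), (∀ b ∈ l, a < b) →
      (l.map fun b => givens a b (t b)).prod *ᵥ Pi.single i (1 : ℝ) = Pi.single i 1 := by
    intro l
    induction l with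
    | nil => intro _; rw [List.map_nil, List.prod_nil, Matrix.one_mulVec]
    | cons b l ih =>
      intro hl
      have hb := hl b (by simp)
      rw [List.map_cons, List.prod_cons, ← Matrix.mulVec_mulVec,
        ih fun x hx => hl x (by simp [hx])]
      ext j
      rw [givens_mulVec_apply hb.ne]
      have h1 := h.ne
      have h2 := (h.trans hb).ne
      by_cases hj : j = a
      · subst hj; simp [h1.symm, h2.symm]
      by_cases hj' : j = b
      · subst hj'; simp [hj, h1.symm, h2.symm]
      · simp [hj, hj']
  exact this _ fun b hb => by simpa using (List.mem_filter.mp hb).2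

theorem transpose_mulVec_of_fixed {n : ℕ} {R : Matrix (Fin n) (Fin n) ℝ} (hR : Rᵀ * R = 1)
    {v : Fin n → ℝ} (h : R *ᵥ v = v) : Rᵀ *ᵥ v = v := by
  conv_lhs => rw [← h, Matrix.mulVec_mulVec, hR, Matrix.one_mulVec]

theorem transpose_mul_self_of_mem {n : ℕ} {R : Matrix (Fin n) (Fin n) ℝ}
    (hR : R ∈ Matrix.specialOrthogonalGroup (Fin n) ℝ) : Rᵀ * R = 1 :=
  (Matrix.mem_orthogonalGroup_iff' _ _).mp (Matrix.mem_specialOrthogonalGroup_iff.mp hR).1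

theorem transpose_mem {n : ℕ} {R : Matrix (Fin n) (Fin n) ℝ}
    (hR : R ∈ Matrix.specialOrthogonalGroup (Fin n) ℝ) :
    Rᵀ ∈ Matrix.specialOrthogonalGroup (Fin n) ℝ := by
  have h := Matrix.mem_specialOrthogonalGroup_iff.mp hR
  rw [Matrix.mem_specialOrthogonalGroup_iff, Matrix.det_transpose, Matrix.mem_orthogonalGroup_iff]
  exact ⟨by rw [Matrix.transpose_transpose]; exact transpose_mul_self_of_mem hR, h.2⟩

theorem dotProduct_mulVec_self {n : ℕ} {R : Matrix (Fin n) (Fin n) ℝ} (hR : Rᵀ * R = 1)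
    (v : Fin n → ℝ) : (R *ᵥ v) ⬝ᵥ (R *ᵥ v) = v ⬝ᵥ v := by
  rw [Matrix.dotProduct_mulVec, Matrix.vecMul_mulVec, hR, Matrix.vecMul_one]

/-- Every rotation is a product of plane rotations, ordered lexicographically. -/
theorem exists_eq_prod_givensRow (ℓ : ℕ) (L pre : List (Site ℓ))
    (hL : pre ++ L = List.finRange (2 * ℓ + 1)) (R : Matrix (Site ℓ) (Site ℓ) ℝ)
    (hR : R ∈ Matrix.specialOrthogonalGroup (Site ℓ) ℝ)
    (hfix : ∀ i ∈ pre, R *ᵥ Pi.single i 1 = Pi.single i 1) :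
    ∃ θ : Site ℓ → Site ℓ → ℝ, R = (L.map fun a => givensRow a (θ a)).prod := by
  induction L generalizing pre R with
  | nil =>
    refine ⟨fun _ _ => 0, ?_⟩
    rw [List.map_nil, List.prod_nil]
    refine Matrix.ext_of_mulVec_single fun i => ?_
    rw [Matrix.one_mulVec]
    refine hfix i ?_
    rw [List.append_nil] at hL
    rw [hL]; exact List.mem_finRange i
  | cons a L ih =>
    have hpw : (pre ++ a :: L).Pairwise (· < ·) := hL ▸ List.pairwise_lt_finRange _
    rw [List.pairwise_append] at hpw
    have hpre : ∀ i ∈ pre, i < a := fun i hi => hpw.2.2 i hi a (by simp)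
    have hpost : ∀ i ∈ L, a < i := (List.pairwise_cons.mp hpw.2.1).1
    have hmem : ∀ i, i ≠ a → i ∉ pre → a < i := by
      intro i h1 h2
      have : i ∈ pre ++ a :: L := hL ▸ List.mem_finRange i
      simp only [List.mem_append, List.mem_cons, h1, h2, false_or] at this
      exact hpost i this
    have hRt := transpose_mul_self_of_mem hR
    -- The transpose fixes the same axes as `R`, so column `a` of `R` has no component along them.
    have hzero : ∀ i ∈ pre, (R *ᵥ Pi.single a 1) i = 0 := by
      intro i hi
      have h1 := congrFun (transpose_mulVec_of_fixed hRt (hfix i hi)) a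
      rw [Matrix.mulVec_single_one, Matrix.col_apply, Matrix.transpose_apply,
        Pi.single_eq_of_ne (hpre i hi).ne'] at h1
      rw [Matrix.mulVec_single_one, Matrix.col_apply, h1]
    obtain ⟨t, c, hc, h⟩ := exists_givens_prod_mulVec a
      ((List.finRange (2 * ℓ + 1)).filter fun b => a < b) (by simp)
      ((List.nodup_finRange _).filter _) (R *ᵥ Pi.single a 1) (by
        intro i h1 h2
        refine hzero i ?_
        by_contra h3
        exact h2 (by simpa using hmem i h1 h3))
    change _ = givensRow a t *ᵥ _ at h
    have hG := givensRow_mem ℓ a t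
    have hGt := transpose_mul_self_of_mem hG
    have hc1 : c = 1 := by
      have hsq : c * c = 1 := by
        have h1 := dotProduct_mulVec_self hRt (Pi.single a 1)
        rw [h, dotProduct_mulVec_self hGt] at h1
        simpa using h1
      -- Length preservation leaves only the sign of `c`. At the last axis no plane remains to
      -- adjust it: there `R` is diagonal, and its determinant decides.
      by_cases hl : ((List.finRange (2 * ℓ + 1)).filter fun b => a < b) = []
      · have hG1 : givensRow a t = 1 := by rw [givensRow, hl]; rfl
        rw [hG1, Matrix.one_mulVec] at h
        have hdiag : R = Matrix.diagonal (Function.update 1 a c) := by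
          refine Matrix.ext_of_mulVec_single fun i => ?_
          by_cases hi : i = a
          · subst hi
            rw [h]; ext j
            simp
          · have : i ∈ pre := by
              by_contra h3
              have : i ∈ ((List.finRange (2 * ℓ + 1)).filter fun b => a < b) := by
                simpa using hmem i hi h3
              rw [hl] at this
              simp at this
            rw [hfix i this]
            simp [hi]
        have hdet := (Matrix.mem_specialOrthogonalGroup_iff.mp hR).2
        rw [hdiag, Matrix.det_diagonal, Finset.prod_update_of_mem (Finset.mem_univ a)] at hdet
        simpa using hdet
      · have := hc hl
        nlinarith
    subst hc1
    -- Removing row `a` leaves a rotation that fixes axis `a` as well as the earlier ones.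
    obtain ⟨θ, hθ⟩ := ih (pre ++ [a]) (by rw [← hL]; simp) ((givensRow a t)ᵀ * R)
      (mul_mem (transpose_mem hG) hR) (by
        intro i hi
        rw [List.mem_append, List.mem_singleton] at hi
        rw [← Matrix.mulVec_mulVec]
        rcases hi with hi | rfl
        · rw [hfix i hi]
          exact transpose_mulVec_of_fixed hGt (givensRow_mulVec_single (hpre i hi) t)
        · rw [h, Matrix.mulVec_mulVec, hGt, Matrix.one_mulVec])
    refine ⟨Function.update θ a t, ?_⟩
    have hmap : (L.map fun x => givensRow x (Function.update θ a t x)) =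
        L.map fun x => givensRow x (θ x) := by
      refine List.map_congr_left fun x hx => ?_
      rw [Function.update_of_ne (hpost x hx).ne']
    rw [List.map_cons, List.prod_cons, hmap, ← hθ, Function.update_self, ← mul_assoc,
      mul_eq_one_comm.mp hGt, one_mul]

theorem covers_list_prod {ℓ : ℕ} {ι : Type*} (l : List ι) {f : ι → VOp ℓ}
    {g : ι → Matrix (Site ℓ) (Site ℓ) ℝ} (h : ∀ i ∈ l, Covers ℓ (f i) (g i)) :
    Covers ℓ (l.map f).prod (l.map g).prod := by
  induction l with
  | nil => exact covers_one ℓ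
  | cons i l ih =>
    rw [List.map_cons, List.map_cons, List.prod_cons, List.prod_cons]
    exact (h i (by simp)).mul (ih fun j hj => h j (by simp [hj]))

theorem covers_spinorProd (ℓ : ℕ) (θ : Site ℓ → Site ℓ → ℝ) :
    Covers ℓ (spinorProd ℓ θ)
      ((List.finRange (2 * ℓ + 1)).map fun a => givensRow a fun b => 2 * θ a b).prod :=
  covers_list_prod _ fun _ _ => covers_list_prod _ fun _ hb =>
    covers_rot ℓ (by simpa using (List.mem_filter.mp hb).2 : _ < _).ne _

theorem spinorProd_mem_spinGates (ℓ : ℕ) (θ : Site ℓ → Site ℓ → ℝ) :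
    spinorProd ℓ θ ∈ spinGates ℓ := by
  refine Submonoid.list_prod_mem _ fun M hM => ?_
  obtain ⟨a, -, rfl⟩ := List.mem_map.mp hM
  refine Submonoid.list_prod_mem _ fun M hM => ?_
  obtain ⟨b, hb, rfl⟩ := List.mem_map.mp hM
  exact rot_mem_spinGates ℓ (by simpa using (List.mem_filter.mp hb).2 : a < b).ne _

theorem exists_spinorProd_covers (ℓ : ℕ) {R : Matrix (Site ℓ) (Site ℓ) ℝ}
    (hR : R ∈ Matrix.specialOrthogonalGroup (Site ℓ) ℝ) :
    ∃ θ, Covers ℓ (spinorProd ℓ θ) R := by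
  obtain ⟨θ, hθ⟩ := exists_eq_prod_givensRow ℓ (List.finRange (2 * ℓ + 1)) [] rfl R hR (by simp)
  refine ⟨fun a b => θ a b / 2, ?_⟩
  have := covers_spinorProd ℓ (fun a b => θ a b / 2)
  simp only [mul_div_cancel₀ _ (two_ne_zero (α := ℝ))] at this
  rwa [hθ]

/-! ### Operators covering the same rotation -/

theorem norm_eq_one_of_smul_one {ℓ : ℕ} {z : ℂ} {V : VOp ℓ} (hV : Vᴴ * V = 1)
    (hU : (z • V)ᴴ * (z • V) = 1) : ‖z‖ = 1 := by
  rw [conjTranspose_smul, smul_mul_smul_comm, hV] at hU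
  have := congrArg Matrix.trace hU
  rw [Matrix.trace_smul, trace_one_vOp, smul_eq_mul,
    mul_eq_right₀ (two_pow_ne_zero_complex ℓ), Complex.star_def, Complex.conj_mul'] at this
  have h2 : ‖z‖ ^ 2 = 1 := by exact_mod_cast this
  exact (pow_eq_one_iff_of_nonneg (norm_nonneg z) two_ne_zero).mp h2

/-- Schur's lemma: `U V†` commutes with every Clifford matrix. -/
theorem eq_smul_of_covers {ℓ : ℕ} {U V : VOp ℓ} {R : Matrix (Site ℓ) (Site ℓ) ℝ}
    (hU : Uᴴ * U = 1) (hV : Vᴴ * V = 1) (hUR : Covers ℓ U R) (hVR : Covers ℓ V R) :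
    ∃ z : ℂ, ‖z‖ = 1 ∧ U = z • V := by
  have hU' : U * Uᴴ = 1 := mul_eq_one_comm.mp hU
  have hV' : V * Vᴴ = 1 := mul_eq_one_comm.mp hV
  obtain ⟨z, hz⟩ := eq_smul_one_of_commute_Γ ℓ (U * Vᴴ) (fun a => by
    have h := (hUR a).trans (hVR a).symm
    calc Γ ℓ a * (U * Vᴴ) = (U * Uᴴ) * Γ ℓ a * U * Vᴴ := by
          rw [hU', one_mul, mul_assoc]
      _ = U * (Uᴴ * Γ ℓ a * U) * Vᴴ := by simp only [mul_assoc]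
      _ = U * Vᴴ * Γ ℓ a * (V * Vᴴ) := by rw [h]; simp only [mul_assoc]
      _ = U * Vᴴ * Γ ℓ a := by rw [hV', mul_one])
  have hUV : U = z • V := by
    calc U = U * Vᴴ * V := by rw [mul_assoc, hV, mul_one]
      _ = z • V := by rw [hz, smul_mul_assoc, one_mul]
  exact ⟨z, norm_eq_one_of_smul_one hV (hUV ▸ hU), hUV⟩

/-! ### Rotations covered by products of vectors -/

/-- A vector `∑ w_i Γ^i` that is invertible covers minus a complex reflection. -/
theorem exists_covers_vector (ℓ : ℕ) (w : Site ℓ → ℂ) (hw : IsUnit (∑ j, w j • Γ ℓ j)) :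
    ∃ R : Matrix (Site ℓ) (Site ℓ) ℂ, R.det = 1 ∧
      ∀ i, Γ ℓ i * (∑ j, w j • Γ ℓ j) = (∑ j, w j • Γ ℓ j) * ∑ j, R i j • Γ ℓ j := by
  set M := ∑ j, w j • Γ ℓ j with hM
  set q := ∑ j, w j * w j with hq
  have hMM : M * M = q • (1 : VOp ℓ) := by
    have h := sum_smul_Γ_anticommutator ℓ w w
    rw [← hM, ← hq, ← two_smul ℂ, mul_smul] at h
    exact smul_right_injective _ (two_ne_zero (α := ℂ)) h
  -- An isotropic vector squares to zero and cannot be invertible.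
  have hq0 : q ≠ 0 := by
    intro h0
    rw [h0, zero_smul] at hMM
    have h := (hw.mul hw)
    rw [hMM] at h
    have h1 := congrArg Matrix.trace (h.mul_left_cancel (by rw [zero_mul, zero_mul] :
      (0 : VOp ℓ) * 1 = 0 * 0))
    rw [trace_one_vOp, Matrix.trace_zero] at h1
    exact two_pow_ne_zero_complex ℓ h1
  have hMΓ : ∀ i, Γ ℓ i * M + M * Γ ℓ i = (2 * w i) • (1 : VOp ℓ) := by
    intro i
    have h := sum_smul_Γ_anticommutator ℓ (Pi.single i 1) w
    rw [← hM] at h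
    simpa [Pi.single_apply, ite_smul] using h
  -- This is minus the reflection `1 - (2/q) w wᵀ`. The reflection has determinant `-1`, and
  -- negation in odd dimension changes this to `1`.
  refine ⟨-(1 + replicateCol Unit (fun i => -(2 / q) * w i) * replicateRow Unit w), ?_, ?_⟩
  · rw [Matrix.det_neg, Matrix.det_one_add_replicateCol_mul_replicateRow]
    have : w ⬝ᵥ (fun i => -(2 / q) * w i) = -2 := by
      calc w ⬝ᵥ (fun i => -(2 / q) * w i) = -(2 / q) * q := by
            rw [hq, Finset.mul_sum, dotProduct]
            exact Finset.sum_congr rfl fun i _ => by ring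
        _ = -2 := by field_simp
    rw [this, Fintype.card_fin, pow_succ, pow_mul]
    norm_num
  · intro i
    have hR : ∑ j, (-(1 + replicateCol Unit (fun i => -(2 / q) * w i) * replicateRow Unit w) :
        Matrix (Site ℓ) (Site ℓ) ℂ) i j • Γ ℓ j = (2 / q * w i) • M - Γ ℓ i := by
      have e : ∀ j, (-(1 + replicateCol Unit (fun i => -(2 / q) * w i) * replicateRow Unit w) :
          Matrix (Site ℓ) (Site ℓ) ℂ) i j = 2 / q * w i * w j - if i = j then 1 else 0 := by
        intro j
        simp [Matrix.mul_apply, Matrix.one_apply]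
        ring
      simp only [e, sub_smul, Finset.sum_sub_distrib, ite_smul, one_smul, zero_smul,
        Finset.sum_ite_eq, Finset.mem_univ, if_true]
      rw [hM, Finset.smul_sum]
      simp only [smul_smul]
    rw [hR, mul_sub, mul_smul_comm, hMM, smul_smul, eq_sub_iff_add_eq, hMΓ]
    congr 1
    field_simp

/-- The relation is an intertwining, not a conjugation by the adjoint, because vectors with complex
coefficients need not be unitary even up to a scalar. -/
theorem exists_covers_vector_prod (ℓ : ℕ) (l : List (Site ℓ → ℂ))
    (hl : IsUnit (l.map fun w => ∑ j, w j • Γ ℓ j).prod) :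
    ∃ R : Matrix (Site ℓ) (Site ℓ) ℂ, R.det = 1 ∧
      ∀ i, Γ ℓ i * (l.map fun w => ∑ j, w j • Γ ℓ j).prod =
        (l.map fun w => ∑ j, w j • Γ ℓ j).prod * ∑ j, R i j • Γ ℓ j := by
  induction l with
  | nil => exact ⟨1, Matrix.det_one, fun i => by simp [Matrix.one_apply]⟩
  | cons w l ih =>
    simp only [List.map_cons, List.prod_cons] at hl ⊢
    rw [Matrix.isUnit_iff_isUnit_det, Matrix.det_mul, IsUnit.mul_iff,
      ← Matrix.isUnit_iff_isUnit_det, ← Matrix.isUnit_iff_isUnit_det] at hl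
    obtain ⟨R, hR, h⟩ := exists_covers_vector ℓ w hl.1
    obtain ⟨R', hR', h'⟩ := ih hl.2
    refine ⟨R * R', by rw [Matrix.det_mul, hR, hR', one_mul], fun i => ?_⟩
    set P := (l.map fun w => ∑ j, w j • Γ ℓ j).prod
    have hc : (∑ k, R i k • Γ ℓ k) * P = P * ∑ j, (R * R') i j • Γ ℓ j := by
      calc (∑ k, R i k • Γ ℓ k) * P = ∑ k, R i k • (Γ ℓ k * P) := by
            simp only [Finset.sum_mul, smul_mul_assoc]
        _ = P * ∑ k, ∑ j, (R i k * R' k j) • Γ ℓ j := by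
            simp only [h', Finset.mul_sum, mul_smul_comm, Finset.smul_sum, smul_smul]
        _ = P * ∑ j, (R * R') i j • Γ ℓ j := by
            rw [Finset.sum_comm]
            simp only [Matrix.mul_apply, Finset.sum_smul]
    rw [← mul_assoc, h i, mul_assoc, hc, ← mul_assoc]

/-- For unitary `U`, the entries of `R` are, up to `2 ^ ℓ`, traces of products of two Hermitian
matrices, hence real. -/
theorem exists_covers_of_intertwines {ℓ : ℕ} {U : VOp ℓ} (hU : Uᴴ * U = 1)
    {R : Matrix (Site ℓ) (Site ℓ) ℂ} (hR : R.det = 1)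
    (h : ∀ i, Γ ℓ i * U = U * ∑ j, R i j • Γ ℓ j) :
    ∃ R' ∈ Matrix.specialOrthogonalGroup (Site ℓ) ℝ, Covers ℓ U R' := by
  have h1 : ∀ i, Uᴴ * Γ ℓ i * U = ∑ j, R i j • Γ ℓ j := by
    intro i
    rw [mul_assoc, h i, ← mul_assoc, hU, one_mul]
  have hreal : ∀ i j, ((R i j).re : ℂ) = R i j := by
    intro i j
    refine Complex.conj_eq_iff_re.mp ?_
    have ht := trace_sum_smul_Γ_mul ℓ (R i) j
    rw [← h1 i] at ht
    have hs : star (Matrix.trace (Uᴴ * Γ ℓ i * U * Γ ℓ j)) =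
        Matrix.trace (Uᴴ * Γ ℓ i * U * Γ ℓ j) := by
      rw [← Matrix.trace_conjTranspose, conjTranspose_mul, conjTranspose_mul, conjTranspose_mul,
        conjTranspose_conjTranspose, Γ_conjTranspose, Γ_conjTranspose, Matrix.trace_mul_comm]
      simp only [mul_assoc]
    rw [ht] at hs
    have h2 : star ((2 : ℂ) ^ ℓ) = 2 ^ ℓ := by simp
    rw [star_mul', h2] at hs
    exact mul_right_cancel₀ (two_pow_ne_zero_complex ℓ) hs
  have hc : Covers ℓ U (R.map Complex.re) := by
    intro i
    rw [h1 i]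
    simp only [Matrix.map_apply, hreal]
  refine ⟨_, Matrix.mem_specialOrthogonalGroup_iff.mpr ⟨hc.mem_orthogonalGroup hU, ?_⟩, hc⟩
  have hmap : (R.map Complex.re).map Complex.ofRealHom = R := by
    ext i j
    exact hreal i j
  have hd := RingHom.map_det Complex.ofRealHom (R.map Complex.re)
  rw [RingHom.mapMatrix_apply, hmap, hR] at hd
  exact Complex.ofReal_eq_one.mp hd

/-! ### The group of induced gates -/

theorem inv_sqrt_ne_zero (ℓ : ℕ) : (((Real.sqrt (2 * ℓ + 1))⁻¹ : ℝ) : ℂ) ≠ 0 := by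
  have : Real.sqrt (2 * ℓ + 1) ≠ 0 := (Real.sqrt_pos.mpr (by positivity)).ne'
  exact_mod_cast inv_ne_zero this

theorem exists_covers_of_mem_inducedGates {ℓ : ℕ} {U : Matrix.unitaryGroup (QIdx ℓ) ℂ}
    (h : U ∈ inducedGates ℓ) :
    ∃ R ∈ Matrix.specialOrthogonalGroup (Site ℓ) ℝ, Covers ℓ U R := by
  obtain ⟨N, W, s, c, -, hc, h⟩ := h
  have hU : (U : VOp ℓ)ᴴ * (U : VOp ℓ) = 1 := Matrix.mem_unitaryGroup_iff'.mp U.2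
  have hU' : IsUnit (U : VOp ℓ) := IsUnit.of_mul_eq_one_right _ hU
  set r := (((Real.sqrt (2 * ℓ + 1))⁻¹ : ℝ) : ℂ) ^ N with hr
  have hr0 : r ≠ 0 := pow_ne_zero _ (inv_sqrt_ne_zero ℓ)
  set l : List (Site ℓ → ℂ) := List.ofFn fun k => W (history s k) (s k) with hl
  have hP : (l.map fun w => ∑ j, w j • Γ ℓ j).prod = (r⁻¹ * c) • (U : VOp ℓ) := by
    refine Matrix.ext_of_mulVec_single fun x => ?_
    have h1 := h (Pi.single x 1)
    rw [postState_eq, ← hr] at h1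
    rw [hl, List.map_ofFn, Matrix.smul_mulVec, mul_smul, ← h1, smul_smul, inv_mul_cancel₀ hr0,
      one_smul]
    rfl
  have hd : r⁻¹ * c ≠ 0 := mul_ne_zero (inv_ne_zero hr0) hc
  obtain ⟨R, hR, hi⟩ := exists_covers_vector_prod ℓ l (by
    rw [hP]; exact hU'.smul (Units.mk0 _ hd))
  refine exists_covers_of_intertwines hU hR fun i => ?_
  have h2 := hi i
  rw [hP, mul_smul_comm, smul_mul_assoc] at h2
  exact smul_right_injective _ hd h2

/-- Every element of the spinor group is a product of operators `V† Γ^j V`. -/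
theorem exists_eq_prod_conj_Γ {ℓ : ℕ} {V : VOp ℓ} (hV : V ∈ spinGates ℓ) :
    ∃ l : List (Site ℓ × spinGates ℓ),
      V = (l.map fun p => (p.2 : VOp ℓ)ᴴ * Γ ℓ p.1 * (p.2 : VOp ℓ)).prod := by
  induction hV using Submonoid.closure_induction with
  | mem V hV =>
    obtain ⟨a, b, h, θ, rfl⟩ := hV
    -- With `V` the half-angle gate, `V† Γ^a V` is `Γ^a` times the gate; a preceding outcome `a` in
    -- the standard basis cancels that `Γ^a`.
    refine ⟨[(a, 1), (a, ⟨rot ℓ a b (θ / 2), rot_mem_spinGates ℓ h _⟩)], ?_⟩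
    simp only [List.map_cons, List.map_nil, List.prod_cons, List.prod_nil, mul_one,
      Submonoid.coe_one, conjTranspose_one, one_mul]
    rw [rot_conj_Γ_of_mem ℓ h (Or.inl rfl), mul_div_cancel₀ _ two_ne_zero, ← mul_assoc,
      Γ_mul_self, one_mul]
  | one => exact ⟨[], rfl⟩
  | mul V V' _ _ h h' =>
    obtain ⟨l, rfl⟩ := h
    obtain ⟨l', rfl⟩ := h'
    exact ⟨l ++ l', by rw [List.map_append, List.prod_append]⟩

theorem mem_inducedGates_of_eq_smul {ℓ : ℕ} {U : Matrix.unitaryGroup (QIdx ℓ) ℂ} {V : VOp ℓ}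
    (hV : V ∈ spinGates ℓ) {z : ℂ} (hz : ‖z‖ = 1) (hU : (U : VOp ℓ) = z • V) :
    U ∈ inducedGates ℓ := by
  have hz0 : z ≠ 0 := by
    rintro rfl
    simp at hz
  obtain ⟨l, rfl⟩ := exists_eq_prod_conj_Γ hV
  -- The number of earlier outcomes identifies the site, since site `k` (counted from `0`) is
  -- measured after `l.length - 1 - k` others. The default `1` occurs only for empty `l`.
  let Vh : List (Site ℓ) → spinGates ℓ := fun h =>
    if hlt : l.length - 1 - h.length < l.length then (l.get ⟨_, hlt⟩).2 else 1
  let s : Fin l.length → Site ℓ := fun k => (l.get k).1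
  have hVh : ∀ k : Fin l.length, Vh (history s k) = (l.get k).2 := by
    intro k
    have hk := k.2
    have hidx : l.length - 1 - (history s k).length = k := by
      rw [history, List.length_drop, List.length_ofFn]
      omega
    have hlt : l.length - 1 - (history s k).length < l.length := by rw [hidx]; exact hk
    simp only [Vh, dif_pos hlt]
    congr 3
  refine ⟨l.length, fun h => measBasis ℓ (Vh h), s,
    (((Real.sqrt (2 * ℓ + 1))⁻¹ : ℝ) : ℂ) ^ l.length * z⁻¹,
    fun h => measBasis_mem_unitaryGroup (Vh h).2,
    mul_ne_zero (pow_ne_zero _ (inv_sqrt_ne_zero ℓ)) (inv_ne_zero hz0), fun L => ?_⟩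
  rw [postState_measBasis (fun h => (Vh h).2), hU, Matrix.smul_mulVec, smul_smul, mul_assoc,
    inv_mul_cancel₀ hz0, mul_one]
  congr 3
  simp only [hVh]
  exact List.ofFn_getElem_eq_map l fun p => (p.2 : VOp ℓ)ᴴ * Γ ℓ p.1 * (p.2 : VOp ℓ)

theorem exists_eq_smul_spinorProd {ℓ : ℕ} {U : VOp ℓ} (hU : Uᴴ * U = 1)
    {R : Matrix (Site ℓ) (Site ℓ) ℝ} (hR : R ∈ Matrix.specialOrthogonalGroup (Site ℓ) ℝ)
    (h : Covers ℓ U R) : ∃ (z : ℂ) (θ : Site ℓ → Site ℓ → ℝ), ‖z‖ = 1 ∧ U = z • spinorProd ℓ θ := by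
  obtain ⟨θ, hθ⟩ := exists_spinorProd_covers ℓ hR
  obtain ⟨z, hz, hUz⟩ := eq_smul_of_covers hU
    (spinGates_conjTranspose_mul_self (spinorProd_mem_spinGates ℓ θ)) h hθ
  exact ⟨z, θ, hz, hUz⟩

theorem Covers.conjTranspose {ℓ : ℕ} {U : VOp ℓ} {R : Matrix (Site ℓ) (Site ℓ) ℝ}
    (hU : U * Uᴴ = 1) (hR : Rᵀ * R = 1) (h : Covers ℓ U R) : Covers ℓ Uᴴ Rᵀ := by
  intro i
  have h1 : ∀ k, Γ ℓ k = ∑ j, (R k j : ℂ) • (U * Γ ℓ j * Uᴴ) := by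
    intro k
    calc Γ ℓ k = (U * Uᴴ) * Γ ℓ k * (U * Uᴴ) := by rw [hU, one_mul, mul_one]
      _ = U * (Uᴴ * Γ ℓ k * U) * Uᴴ := by simp only [mul_assoc]
      _ = _ := by rw [h k]; simp [Finset.mul_sum, Finset.sum_mul]
  have h2 : ∀ j, ∑ k, (R k i : ℂ) * (R k j : ℂ) = if i = j then 1 else 0 := by
    intro j
    have := congrFun (congrFun hR i) j
    rw [Matrix.mul_apply, Matrix.one_apply] at this
    simp only [Matrix.transpose_apply] at this
    have h3 := congrArg (fun x : ℝ => (x : ℂ)) this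
    push_cast at h3
    rw [h3]
    split_ifs <;> simp
  rw [conjTranspose_conjTranspose]
  conv_rhs =>
    enter [2, k]
    rw [h1 k, Finset.smul_sum]
  rw [Finset.sum_comm]
  simp only [Matrix.transpose_apply, smul_smul, ← Finset.sum_smul, h2, ite_smul, one_smul,
    zero_smul, Finset.sum_ite_eq, Finset.mem_univ, if_true]

/-- The unitaries that cover a rotation. -/
def coveringGroup (ℓ : ℕ) : Subgroup (Matrix.unitaryGroup (QIdx ℓ) ℂ) where
  carrier := {U | ∃ R ∈ Matrix.specialOrthogonalGroup (Site ℓ) ℝ, Covers ℓ U R}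
  one_mem' := ⟨1, one_mem _, covers_one ℓ⟩
  mul_mem' := by
    rintro U U' ⟨R, hR, h⟩ ⟨R', hR', h'⟩
    exact ⟨R * R', mul_mem hR hR', h.mul h'⟩
  inv_mem' := by
    rintro U ⟨R, hR, h⟩
    exact ⟨Rᵀ, transpose_mem hR,
      h.conjTranspose (Matrix.mem_unitaryGroup_iff.mp U.2) (transpose_mul_self_of_mem hR)⟩

/-- The rotation covered by a unitary. -/
def coveredRotation (ℓ : ℕ) : coveringGroup ℓ →* Matrix.specialOrthogonalGroup (Site ℓ) ℝ where
  -- The covered rotation is unique by `Covers.eq`, so the choice is multiplicative.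
  toFun U := ⟨U.2.choose, U.2.choose_spec.1⟩
  map_one' := Subtype.ext
    (((1 : coveringGroup ℓ).2.choose_spec.2).eq (covers_one ℓ))
  map_mul' U U' := Subtype.ext
    (((U * U').2.choose_spec.2).eq (U.2.choose_spec.2.mul U'.2.choose_spec.2))

theorem covers_coveredRotation {ℓ : ℕ} (U : coveringGroup ℓ) :
    Covers ℓ (U : Matrix.unitaryGroup (QIdx ℓ) ℂ) (coveredRotation ℓ U) :=
  U.2.choose_spec.2

theorem coveringGroup_conjTranspose_mul_self {ℓ : ℕ} (U : coveringGroup ℓ) :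
    ((U : Matrix.unitaryGroup (QIdx ℓ) ℂ) : VOp ℓ)ᴴ *
      ((U : Matrix.unitaryGroup (QIdx ℓ) ℂ) : VOp ℓ) = 1 :=
  Matrix.mem_unitaryGroup_iff'.mp U.1.2

/-- Closure under products and inverses is plain for covering unitaries; this equality transfers it
to the induced gates. -/
theorem coe_coveringGroup (ℓ : ℕ) :
    (coveringGroup ℓ : Set (Matrix.unitaryGroup (QIdx ℓ) ℂ)) = inducedGates ℓ := by
  ext U
  constructor
  · rintro ⟨R, hR, h⟩
    obtain ⟨z, θ, hz, hU⟩ := exists_eq_smul_spinorProd (Matrix.mem_unitaryGroup_iff'.mp U.2) hR h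
    exact mem_inducedGates_of_eq_smul (spinorProd_mem_spinGates ℓ θ) hz hU
  · exact exists_covers_of_mem_inducedGates

theorem exists_mem_coveringGroup {ℓ : ℕ} {V : VOp ℓ} (hV : V ∈ spinGates ℓ) :
    ∃ U : coveringGroup ℓ, ((U : Matrix.unitaryGroup (QIdx ℓ) ℂ) : VOp ℓ) = V :=
  ⟨⟨⟨V, spinGates_mem_unitaryGroup hV⟩, exists_covers_of_mem_spinGates hV⟩, rfl⟩

theorem exists_spinorProd_eq (ℓ : ℕ) (R : Matrix.specialOrthogonalGroup (Site ℓ) ℝ) :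
    ∃ θ : Site ℓ → Site ℓ → ℝ, ∃ U : coveringGroup ℓ,
      ((U : Matrix.unitaryGroup (QIdx ℓ) ℂ) : VOp ℓ) = spinorProd ℓ θ ∧
        coveredRotation ℓ U = R := by
  obtain ⟨θ, hθ⟩ := exists_spinorProd_covers ℓ R.2
  obtain ⟨U, hU⟩ := exists_mem_coveringGroup (spinorProd_mem_spinGates ℓ θ)
  have := covers_coveredRotation U
  rw [hU] at this
  exact ⟨θ, U, hU, Subtype.ext (this.eq hθ)⟩

theorem coveredRotation_eq_one_iff {ℓ : ℕ} (U : coveringGroup ℓ) :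
    coveredRotation ℓ U = 1 ↔
      ∃ z : ℂ, ‖z‖ = 1 ∧ ((U : Matrix.unitaryGroup (QIdx ℓ) ℂ) : VOp ℓ) = z • 1 := by
  have hc := covers_coveredRotation U
  constructor
  · intro h
    rw [h] at hc
    exact eq_smul_of_covers (coveringGroup_conjTranspose_mul_self U) (by simp) hc (covers_one ℓ)
  · rintro ⟨z, hz, hU⟩
    rw [hU] at hc
    exact Subtype.ext (hc.eq ((covers_one ℓ).smul hz))

/-! ### Uniqueness of the tensor -/

theorem sum_givens_smul {n : ℕ} {M : Type*} [AddCommGroup M] [Module ℂ M] {a b : Fin n}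
    (h : a ≠ b) (t : ℝ) (A : Fin n → M) (i : Fin n) :
    ∑ j, (givens a b t i j : ℂ) • A j =
      if i = a then (Real.cos t : ℂ) • A a - (Real.sin t : ℂ) • A b
      else if i = b then (Real.sin t : ℂ) • A a + (Real.cos t : ℂ) • A b else A i := by
  have key : ∀ f : Fin n → M, (∀ j, j ≠ a → j ≠ b → f j = 0) → ∑ j, f j = f a + f b := by
    intro f hf
    exact Finset.sum_eq_add a b h (fun j _ hj => hf j hj.1 hj.2) (by simp) (by simp)
  by_cases ha : i = a
  · rw [key _ (by intro j h1 h2; simp [givens, ha, h1, h2])]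
    simp [givens, ha, h.symm, sub_eq_add_neg]
  by_cases hb : i = b
  · rw [key _ (by intro j h1 h2; simp [givens, hb, h.symm, h1, h2])]
    simp [givens, hb, h.symm]
  · simp [givens, ha, hb]

theorem sum_kraus (ℓ : ℕ) : ∑ a, (kraus ℓ a)ᴴ * kraus ℓ a = 1 := by
  have h : ∀ a, (kraus ℓ a)ᴴ * kraus ℓ a = (((2 * ℓ + 1 : ℝ)⁻¹ : ℝ) : ℂ) • (1 : VOp ℓ) := by
    intro a
    rw [kraus, conjTranspose_smul, smul_mul_smul_comm, Γ_conjTranspose, Γ_mul_self,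
      Complex.star_def, Complex.conj_ofReal, ← Complex.ofReal_mul, ← mul_inv,
      Real.mul_self_sqrt (by positivity)]
  simp only [h, Finset.sum_const, Finset.card_univ, Fintype.card_fin]
  rw [← Nat.cast_smul_eq_nsmul ℂ, smul_smul]
  have h0 : (2 * (ℓ : ℂ) + 1) ≠ 0 := by exact_mod_cast Nat.succ_ne_zero (2 * ℓ)
  push_cast
  rw [mul_inv_cancel₀ h0, one_smul]

theorem isAKLTTensor_smul_kraus (ℓ : ℕ) {z : ℂ} (hz : ‖z‖ = 1) :
    IsAKLTTensor ℓ fun a => z • kraus ℓ a := by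
  have hzz : star z * z = 1 := by
    rw [Complex.star_def, Complex.conj_mul', hz]; norm_num
  constructor
  · simp only [conjTranspose_smul, smul_mul_smul_comm, hzz, one_smul, sum_kraus]
  · intro R _ V _ h i
    simp only [kraus, mul_smul_comm, smul_mul_assoc, h i, Finset.smul_sum]
    refine Finset.sum_congr rfl fun j _ => ?_
    simp only [smul_smul]
    congr 1
    ring

theorem IsAKLTTensor.conj_rot {ℓ : ℕ} {A : Site ℓ → VOp ℓ} (hA : IsAKLTTensor ℓ A) {b c : Site ℓ}
    (h : b ≠ c) (θ : ℝ) (i : Site ℓ) :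
    (if i = b then (Real.cos (2 * θ) : ℂ) • A b - (Real.sin (2 * θ) : ℂ) • A c
      else if i = c then (Real.sin (2 * θ) : ℂ) • A b + (Real.cos (2 * θ) : ℂ) • A c else A i) =
      (rot ℓ b c θ)ᴴ * A i * rot ℓ b c θ := by
  rw [← sum_givens_smul h]
  exact hA.2 _ (givens_mem ℓ h _) _ (rot_mem_spinGates ℓ h θ) (covers_rot ℓ h θ) i

/-- At `θ = π/2` the gate is `-Γ^b Γ^c` and covers the half turn that negates axes `b` and `c`. -/
theorem IsAKLTTensor.pair_mul {ℓ : ℕ} {A : Site ℓ → VOp ℓ} (hA : IsAKLTTensor ℓ A) {b c : Site ℓ}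
    (h : b ≠ c) (i : Site ℓ) :
    (Γ ℓ b * Γ ℓ c) * A i =
      (if i = b ∨ i = c then (-1 : ℂ) else 1) • (A i * (Γ ℓ b * Γ ℓ c)) := by
  have h1 := hA.conj_rot h (Real.pi / 2) i
  have hV := rot_conjTranspose_mul_self ℓ h (Real.pi / 2)
  have hV' : rot ℓ b c (Real.pi / 2) * (rot ℓ b c (Real.pi / 2))ᴴ = 1 := mul_eq_one_comm.mp hV
  have h2 : (if i = b ∨ i = c then (-1 : ℂ) else 1) • A i =
      (rot ℓ b c (Real.pi / 2))ᴴ * A i * rot ℓ b c (Real.pi / 2) := by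
    rw [← h1, mul_div_cancel₀ _ (two_ne_zero (α := ℝ)), Real.cos_pi, Real.sin_pi]
    by_cases hb : i = b
    · simp [hb]
    by_cases hc : i = c
    · simp [hc, h.symm]
    · simp [hb, hc]
  have h3 := congrArg (fun X => rot ℓ b c (Real.pi / 2) * X) h2
  simp only [← mul_assoc, hV', one_mul] at h3
  have hJ : rot ℓ b c (Real.pi / 2) = -(Γ ℓ b * Γ ℓ c) := by
    simp [rot_eq ℓ h]
  rw [hJ, mul_smul_comm, neg_mul, mul_neg, smul_neg, neg_inj] at h3
  rw [← h3, smul_smul]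
  split_ifs <;> simp

theorem IsAKLTTensor.exists_eq_smul_Γ {ℓ : ℕ} {A : Site ℓ → VOp ℓ} (hA : IsAKLTTensor ℓ A)
    (a : Site ℓ) : ∃ z : ℂ, A a = z • Γ ℓ a := by
  obtain ⟨z, hz⟩ := eq_smul_one_of_commute_even ℓ (A a * Γ ℓ a) (fun b c h => by
    rw [← mul_assoc, hA.pair_mul h a]
    by_cases ha : a = b ∨ a = c
    · rw [if_pos ha, neg_smul, one_smul, neg_mul, mul_assoc, mul_assoc (A a) (Γ ℓ a),
        Γ_mul_pair_of_mem ℓ h ha, mul_neg]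
    · rw [if_neg ha, one_smul, mul_assoc, mul_assoc (A a) (Γ ℓ a)]
      rw [not_or] at ha
      rw [Γ_mul_pair_of_notMem ℓ ha.1 ha.2])
  refine ⟨z, ?_⟩
  calc A a = A a * Γ ℓ a * Γ ℓ a := by rw [mul_assoc, Γ_mul_self, mul_one]
    _ = z • Γ ℓ a := by rw [hz, smul_mul_assoc, one_mul]

theorem smul_Γ_injective (ℓ : ℕ) (a : Site ℓ) {z z' : ℂ} (h : z • Γ ℓ a = z' • Γ ℓ a) :
    z = z' := by
  have := congrArg (fun M => Matrix.trace (M * Γ ℓ a)) h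
  simp only [smul_mul_assoc, Γ_mul_self, Matrix.trace_smul, trace_one_vOp, smul_eq_mul] at this
  exact mul_right_cancel₀ (two_pow_ne_zero_complex ℓ) this

theorem isAKLTTensor_iff (ℓ : ℕ) (A : Site ℓ → VOp ℓ) :
    IsAKLTTensor ℓ A ↔ ∃ z : ℂ, ‖z‖ = 1 ∧ ∀ a, A a = z • kraus ℓ a := by
  constructor
  · intro hA
    choose z hz using hA.exists_eq_smul_Γ
    have hzz : ∀ a, z a = z 0 := by
      intro a
      by_cases ha : a = 0
      · rw [ha]
      -- A quarter turn takes both `A 0` to `A a` and `Γ^0` to `Γ^a`.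
      · have h1 := hA.conj_rot ha (Real.pi / 4) 0
        rw [if_neg (Ne.symm ha), if_pos rfl, hz 0, mul_smul_comm, smul_mul_assoc,
          covers_rot ℓ ha, sum_givens_smul ha, if_neg (Ne.symm ha), if_pos rfl, hz a,
          show 2 * (Real.pi / 4) = Real.pi / 2 by ring, Real.sin_pi_div_two,
          Real.cos_pi_div_two] at h1
        simp only [Complex.ofReal_one, Complex.ofReal_zero, one_smul, zero_smul, add_zero] at h1
        exact smul_Γ_injective ℓ a h1
    have hs : Real.sqrt (2 * ℓ + 1) ≠ 0 := (Real.sqrt_pos.mpr (by positivity)).ne'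
    have hA' : ∀ a, A a = (z 0 * (Real.sqrt (2 * ℓ + 1) : ℝ)) • kraus ℓ a := by
      intro a
      rw [hz a, hzz a, kraus, smul_smul, mul_assoc, ← Complex.ofReal_mul, mul_inv_cancel₀ hs,
        Complex.ofReal_one, mul_one]
    refine ⟨_, ?_, hA'⟩
    refine norm_eq_one_of_smul_one (ℓ := ℓ) (V := 1) (by simp) ?_
    have h1 := hA.1
    simp only [hA', conjTranspose_smul, smul_mul_smul_comm, ← Finset.smul_sum, sum_kraus] at h1
    rw [conjTranspose_smul, smul_mul_smul_comm, conjTranspose_one, one_mul, h1]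
  · rintro ⟨z, hz, hA⟩
    rw [show A = fun a => z • kraus ℓ a from funext hA]
    exact isAKLTTensor_smul_kraus ℓ hz

/-! ### Byproducts and success probability -/

theorem byproducts_conjTranspose_mul_self {ℓ : ℕ} {B : VOp ℓ} (hB : B ∈ byproducts ℓ) :
    Bᴴ * B = 1 := by
  induction hB using Submonoid.closure_induction with
  | mem B hB =>
    obtain ⟨a, rfl⟩ := hB
    rw [Γ_conjTranspose, Γ_mul_self]
  | one => simp
  | mul B C _ _ h h' => rw [conjTranspose_mul, mul_assoc, ← mul_assoc Bᴴ, h, one_mul, h']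

/-- A byproduct commutes with a gate up to the sign of the angle. -/
theorem exists_sign_byproduct_mul_rot {ℓ : ℕ} {B : VOp ℓ} (hB : B ∈ byproducts ℓ)
    {a b : Site ℓ} (h : a ≠ b) :
    ∃ ε : ℝ, (ε = 1 ∨ ε = -1) ∧ ∀ φ, B * rot ℓ a b φ = rot ℓ a b (ε * φ) * B := by
  induction hB using Submonoid.closure_induction with
  | mem B hB =>
    obtain ⟨j, rfl⟩ := hB
    by_cases hj : j = a ∨ j = b
    · exact ⟨-1, Or.inr rfl, fun φ => by rw [neg_one_mul, Γ_mul_rot_of_mem ℓ h hj]⟩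
    · rw [not_or] at hj
      exact ⟨1, Or.inl rfl, fun φ => by rw [one_mul, Γ_mul_rot_of_notMem ℓ h hj.1 hj.2]⟩
  | one => exact ⟨1, Or.inl rfl, fun φ => by simp⟩
  | mul B C _ _ hB hC =>
    obtain ⟨ε, hε, hB⟩ := hB
    obtain ⟨ε', hε', hC⟩ := hC
    refine ⟨ε * ε', ?_, fun φ => ?_⟩
    · rcases hε with rfl | rfl <;> rcases hε' with rfl | rfl <;> simp
    · rw [mul_assoc, hC, ← mul_assoc, hB, mul_assoc, mul_assoc]

theorem postState_one_measBasis {ℓ : ℕ} {V : VOp ℓ} (hV : V ∈ spinGates ℓ) (j : Site ℓ)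
    (L : QIdx ℓ → ℂ) :
    postState (fun _ => measBasis ℓ V) (fun _ : Fin 1 => j) L =
      (((Real.sqrt (2 * ℓ + 1))⁻¹ : ℝ) : ℂ) • ((Vᴴ * Γ ℓ j * V) *ᵥ L) := by
  rw [postState_measBasis (V := fun _ => V) fun _ => hV]
  simp

theorem performs_of_eq {ℓ : ℕ} {V B G : VOp ℓ} (hV : V ∈ spinGates ℓ) {j : Site ℓ}
    (h : Vᴴ * Γ ℓ j * V * B = Γ ℓ j * B * G) : Performs ℓ (measBasis ℓ V) B G j :=
  ⟨_, inv_sqrt_ne_zero ℓ, fun ψ => by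
    rw [postState_one_measBasis hV, Matrix.mulVec_mulVec, h]⟩

/-- Both gates follow the same invertible operator `Γ^j B`, which cancels. Thus no outcome can count
for two gates that are not proportional. -/
theorem eq_smul_of_performs {ℓ : ℕ} {W : Matrix (Site ℓ) (Site ℓ) ℂ} {B G G' : VOp ℓ} {j : Site ℓ}
    (hB : Bᴴ * B = 1) (h : Performs ℓ W B G j) (h' : Performs ℓ W B G' j) :
    ∃ d : ℂ, G = d • G' := by
  obtain ⟨c, hc, h⟩ := h
  obtain ⟨c', -, h'⟩ := h'
  have h1 : c • (Γ ℓ j * B * G) = c' • (Γ ℓ j * B * G') := by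
    refine Matrix.ext_of_mulVec_single fun x => ?_
    rw [Matrix.smul_mulVec, Matrix.smul_mulVec, ← h, h']
  have hinv : Bᴴ * Γ ℓ j * (Γ ℓ j * B) = 1 := by
    rw [mul_assoc, ← mul_assoc (Γ ℓ j), Γ_mul_self, one_mul, hB]
  have h2 := congrArg (fun X => Bᴴ * Γ ℓ j * X) h1
  simp only [mul_smul_comm] at h2
  rw [← mul_assoc, ← mul_assoc _ _ G', hinv, one_mul, one_mul] at h2
  exact ⟨c⁻¹ * c', by rw [mul_smul, ← h2, smul_smul, inv_mul_cancel₀ hc, one_smul]⟩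

/-- The trace forces `d = cos φ`, leaving `sin φ • (Γ^a Γ^b) = 0`, although `Γ^a Γ^b` squares to
`-1`. -/
theorem rot_ne_smul_one {ℓ : ℕ} {a b : Site ℓ} (h : a ≠ b) {φ : ℝ} (hφ : Real.sin φ ≠ 0) (d : ℂ) :
    rot ℓ a b φ ≠ d • 1 := by
  intro hd
  rw [rot_eq ℓ h] at hd
  have h1 := congrArg Matrix.trace hd
  rw [Matrix.trace_sub, Matrix.trace_smul, Matrix.trace_smul, Matrix.trace_smul, trace_Γ_mul_Γ,
    if_neg h, smul_zero, sub_zero, trace_one_vOp] at h1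
  have h2 := mul_right_cancel₀ (two_pow_ne_zero_complex ℓ) h1
  rw [h2, sub_eq_self, smul_eq_zero] at hd
  have hJ : Γ ℓ a * Γ ℓ b = 0 := hd.resolve_left (by exact_mod_cast hφ)
  have h3 := Γ_mul_Γ_sq ℓ h
  rw [hJ, zero_mul] at h3
  have h4 := congrArg Matrix.trace h3
  rw [Matrix.trace_zero, Matrix.trace_neg, trace_one_vOp, zero_eq_neg] at h4
  exact two_pow_ne_zero_complex ℓ h4

open Classical in
theorem performProb_measBasis {ℓ : ℕ} {V B G : VOp ℓ} (hV : V ∈ spinGates ℓ) (S : Finset (Site ℓ))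
    (hS : ∀ j, Performs ℓ (measBasis ℓ V) B G j ↔ j ∈ S) {χ : QIdx ℓ → ℂ} (hχ : normSq χ = 1) :
    performProb ℓ (measBasis ℓ V) B G χ = S.card / (2 * (ℓ : ℝ) + 1) := by
  have hf : Finset.univ.filter (fun j => Performs ℓ (measBasis ℓ V) B G j) = S := by
    ext j
    simp [hS]
  rw [performProb, hf, Finset.sum_congr rfl fun j _ =>
    outcomeProb_measBasis (V := fun _ => V) (fun _ => hV) (fun _ : Fin 1 => j) hχ,
    Finset.sum_const, nsmul_eq_mul, pow_one, mul_one_div]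

end SOAKLT

end

theorem proposition4 (ℓ : ℕ) (hℓ : 1 ≤ ℓ) :
    -- the state: the Clifford tensor is, up to a phase, the only AKLT tensor
    (∀ A : Site ℓ → VOp ℓ, IsAKLTTensor ℓ A ↔
      ∃ z : ℂ, ‖z‖ = 1 ∧ ∀ a, A a = z • kraus ℓ a) ∧
    -- the byproducts are tensor products of Pauli operators
    (∀ a, ∃ p : Fin ℓ → Fin 4, Γ ℓ a = pauliString ℓ p) ∧
    (∀ B ∈ byproducts ℓ, ∃ (z : ℂ) (p : Fin ℓ → Fin 4), z ^ 4 = 1 ∧ B = z • pauliString ℓ p) ∧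
    -- the gates induced by on-site measurements form `SO(2ℓ+1)` (modulo global phases)
    (∃ (G : Subgroup (Matrix.unitaryGroup (QIdx ℓ) ℂ))
        (π : G →* Matrix.specialOrthogonalGroup (Site ℓ) ℝ),
      (G : Set (Matrix.unitaryGroup (QIdx ℓ) ℂ)) = inducedGates ℓ ∧
      (∀ U : G, Covers ℓ (U : Matrix.unitaryGroup (QIdx ℓ) ℂ) (π U)) ∧
      Function.Surjective π ∧
      (∀ U : G, π U = 1 ↔
        ∃ z : ℂ, ‖z‖ = 1 ∧ ((U : Matrix.unitaryGroup (QIdx ℓ) ℂ) : VOp ℓ) = z • 1) ∧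
      -- spinor form of the gates
      (∀ V ∈ spinGates ℓ, ∃ U : G, ((U : Matrix.unitaryGroup (QIdx ℓ) ℂ) : VOp ℓ) = V) ∧
      (∀ R, ∃ θ : Site ℓ → Site ℓ → ℝ, ∃ U : G,
        ((U : Matrix.unitaryGroup (QIdx ℓ) ℂ) : VOp ℓ) = spinorProd ℓ θ ∧ π U = R) ∧
      (∀ U : G, ∃ (z : ℂ) (θ : Site ℓ → Site ℓ → ℝ), ‖z‖ = 1 ∧
        ((U : Matrix.unitaryGroup (QIdx ℓ) ℂ) : VOp ℓ) = z • spinorProd ℓ θ)) ∧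
    -- the measurement bases are given by rotations
    (∀ V ∈ spinGates ℓ, ∃ R ∈ Matrix.specialOrthogonalGroup (Site ℓ) ℝ,
      Covers ℓ V R ∧ measBasis ℓ V = R.map (fun x : ℝ => (x : ℂ))) ∧
    -- measuring in these bases induces the operators `V† Γ^j V`, all outcomes equally likely
    (∀ (N : ℕ) (V : List (Site ℓ) → VOp ℓ), (∀ h, V h ∈ spinGates ℓ) →
      ∀ (s : Fin N → Site ℓ) (L : QIdx ℓ → ℂ),
        postState (fun h => measBasis ℓ (V h)) s L =
          ((((Real.sqrt (2 * ℓ + 1))⁻¹ : ℝ) : ℂ) ^ N) •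
            ((List.ofFn fun k =>
              (V (history s k))ᴴ * Γ ℓ (s k) * V (history s k)).prod *ᵥ L) ∧
        (normSq L = 1 →
          outcomeProb (fun h => measBasis ℓ (V h)) s L = (1 / (2 * (ℓ : ℝ) + 1)) ^ N)) ∧
    -- each gate `exp(-iφ Γ^{ab})` is performed with probability `2/(2ℓ+1)`, whatever byproduct
    -- has accumulated; otherwise the identity is performed, up to a byproduct
    (∀ B ∈ byproducts ℓ, ∀ a b : Site ℓ, a ≠ b → ∃ ε : ℝ, (ε = 1 ∨ ε = -1) ∧
      ∀ φ : ℝ,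
        B * rot ℓ a b φ = rot ℓ a b (ε * φ) * B ∧
        (∀ j, j = a ∨ j = b →
          Performs ℓ (measBasis ℓ (rot ℓ a b (ε * φ / 2))) B (rot ℓ a b φ) j) ∧
        (∀ j, j ≠ a → j ≠ b →
          Performs ℓ (measBasis ℓ (rot ℓ a b (ε * φ / 2))) B 1 j) ∧
        (Real.sin φ ≠ 0 → ∀ χ : QIdx ℓ → ℂ, normSq χ = 1 →
          performProb ℓ (measBasis ℓ (rot ℓ a b (ε * φ / 2))) B (rot ℓ a b φ) χ
            = 2 / (2 * (ℓ : ℝ) + 1) ∧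
          performProb ℓ (measBasis ℓ (rot ℓ a b (ε * φ / 2))) B 1 χ
            = 1 - 2 / (2 * (ℓ : ℝ) + 1))) := by
  refine ⟨isAKLTTensor_iff ℓ, Γ_eq_pauliString ℓ, fun B hB => byproduct_eq_smul_pauliString ℓ hB,
    ⟨coveringGroup ℓ, coveredRotation ℓ, coe_coveringGroup ℓ, covers_coveredRotation, fun R => ?_,
      coveredRotation_eq_one_iff, fun V hV => exists_mem_coveringGroup hV, exists_spinorProd_eq ℓ,
      fun U => exists_eq_smul_spinorProd (coveringGroup_conjTranspose_mul_self U)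
        (coveredRotation ℓ U).2 (covers_coveredRotation U)⟩,
    fun V hV => ?_, fun N V hV s L => ⟨postState_measBasis hV s L, outcomeProb_measBasis hV s⟩,
    fun B hB a b h => ?_⟩
  · obtain ⟨-, U, -, hU⟩ := exists_spinorProd_eq ℓ R
    exact ⟨U, hU⟩
  · obtain ⟨R, hR, h⟩ := exists_covers_of_mem_spinGates hV
    exact ⟨R, hR, h, h.measBasis_eq⟩
  · obtain ⟨ε, hε, hBr⟩ := exists_sign_byproduct_mul_rot hB h
    refine ⟨ε, hε, fun φ => ?_⟩
    have hV := rot_mem_spinGates ℓ h (ε * φ / 2)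
    have hB1 := byproducts_conjTranspose_mul_self hB
    -- Conjugation doubles `ε * φ / 2` to `ε * φ`, and moving the gate through `B` removes the sign
    -- `ε`.
    have hgate : ∀ j, j = a ∨ j = b →
        Performs ℓ (measBasis ℓ (rot ℓ a b (ε * φ / 2))) B (rot ℓ a b φ) j := fun j hj =>
      performs_of_eq hV (by
        rw [rot_conj_Γ_of_mem ℓ h hj, mul_div_cancel₀ _ two_ne_zero, mul_assoc, ← hBr, mul_assoc])
    have hid : ∀ j, j ≠ a → j ≠ b →
        Performs ℓ (measBasis ℓ (rot ℓ a b (ε * φ / 2))) B 1 j := fun j ha hb =>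
      performs_of_eq hV (by rw [rot_conj_Γ_of_notMem ℓ h ha hb, mul_one])
    refine ⟨hBr φ, hgate, hid, fun hφ χ hχ => ⟨?_, ?_⟩⟩
    · rw [performProb_measBasis hV {a, b} (fun j => ?_) hχ, Finset.card_pair h, Nat.cast_ofNat]
      rw [Finset.mem_insert, Finset.mem_singleton]
      refine ⟨fun hj => ?_, hgate j⟩
      -- Any other outcome performs the identity, so performing the gate too would make the gate a
      -- scalar.
      by_contra hab
      rw [not_or] at hab
      obtain ⟨d, hd⟩ := eq_smul_of_performs hB1 hj (hid j hab.1 hab.2)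
      exact rot_ne_smul_one h hφ d hd
    · rw [performProb_measBasis hV {a, b}ᶜ (fun j => ?_) hχ]
      · have hn : 2 ≤ 2 * ℓ + 1 := by omega
        rw [Finset.card_compl, Finset.card_pair h, Fintype.card_fin, Nat.cast_sub hn]
        have : 2 * (ℓ : ℝ) + 1 ≠ 0 := by positivity
        push_cast
        field_simp
      · rw [Finset.mem_compl, Finset.mem_insert, Finset.mem_singleton]
        refine ⟨fun hj hab => ?_, fun hab => ?_⟩
        · obtain ⟨d, hd⟩ := eq_smul_of_performs hB1 (hgate j hab) hj
          exact rot_ne_smul_one h hφ d hd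
        · rw [not_or] at hab
          exact hid j hab.1 hab.2
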